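/- Let $M$ be a loopless matroid of rank $d+1\ge 1$ on $E=\{0,\dots,n\}$. For a matroid $N$ whose ground set is a subset of $E$, with the induced order, let $T(N;x,y)=\sum_{B}x^{\mathrm{in}(B)}y^{\mathrm{ex}(B)}=\sum_{i,j}t_{i,j}(N)x^iy^j$ be its Tutte polynomial, where $B$ runs over the bases of $N$, $\mathrm{in}(B)$ is the number of $e\in B$ with $e=\min\{e' : (B\setminus e)\cup e' \text{ is a basis}\}$, and $\mathrm{ex}(B)$ is the number of $e\notin B$ with $e=\min\{e' : (B\cup e)\setminus e'\text{ is a basis}\}$. Let $\beta(N)=t_{1,0}(N)$. Work in $\mathbb R^{n+1}/\mathbb R(1,\dots,1)$ with the lattice $\Lambda=\mathbb Z^{n+1}/\mathbb Z(1,\dots,1)$. For a flag of flats $\mathcal F:\varnothing=F_0\subsetneq F_1\subsetneq\dots\subsetneq F_{j+1}=E$ of a loopless matroid on $E$, let $\sigma_{\mathcal F}$ be the $j$-dimensional cone spanned by the classes of the indicator vectors $\mathbf e_{F_1},\dots,\mathbf e_{F_j}$. The Bergman fan of the matroid consists of the cones $\sigma_{\mathcal F}$, with weight $1$ on the cones of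 maximal dimension. For $0\le k\le d$ the $k$-th Chern–Schwartz–MacPherson cycle $\mathrm{csm}_k(M)$ is the $k$-skeleton of the Bergman fan of $M$, in which the $k$-dimensional cone $\sigma_{\mathcal F}$ has weight $$(-1)^{d-k}\prod_{i=0}^{k}\beta(M|F_{i+1}/F_i).$$ For fans $\Sigma,\Sigma'$ with weights $c,c'$ on their cones of maximal dimension, call $v$ generic if the linear spans of $\sigma$ and $\sigma'$ together span the ambient space whenever $\sigma\in\Sigma$, $\sigma'\in\Sigma'$ are cones with $\sigma\cap(\sigma'+v)\ne\varnothing$. For generic $v$ the stable intersection $\Sigma\cdot\Sigma'$ has support $\lim_{\varepsilon\to0^+}|\Sigma|\cap(|\Sigma'|+\varepsilon v)$, and the weight of a point $p$ of it is $$m(p)=\sum c(\sigma)\,c'(\sigma')\,[\Lambda:\Lambda_\sigma+\Lambda_{\sigma'}],$$ the sum being over the pairs of cones $\sigma\in\Sigma$, $\sigma'\in\Sigma'$ of maximal dimension with $p\in\sigma\cap\sigma'$ and $\sigma\cap(\sigma'+v)\neq\varnothing$, where $\Lambda_\sigma$ is the set of points of $\Lambda$ in the linear span of $\sigma$. The degree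 $\deg\mathcal T$ of a $k$-dimensional cycle $\mathcal T$ is $\sum_p m(p)$ over the points $p$ of the stable intersection of $\mathcal T$ with the $(n-k)$-dimensional Bergman fan of the uniform matroid of rank $n-k+1$ on $E$. **Theorem.** For every $k\in\{0,\dots,d\}$, the generic $v$ for $\mathrm{csm}_k(M)$ and this Bergman fan are dense; and for every generic $v$ the support of the stable intersection is finite and $$\deg(\mathrm{csm}_k(M))=(-1)^{d-k}\,t_{k+1,0}(M).$$ -/

import Mathlib

open scoped Matroid

noncomputable section

namespace CSM

/-! ### Activities and the Tutte polynomial -/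

section Tutte

variable {α : Type*} [LinearOrder α]

/-- The fundamental circuit `γ(e; B) = {e' ∈ E : (B ∪ e) \ e' is a basis}`, for `e ∈ E \ B`. -/
def fundCircuit (M : Matroid α) (B : Set α) (e : α) : Set α :=
  {e' | e' ∈ M.E ∧ M.IsBase (insert e B \ {e'})}

/-- The fundamental cocircuit `γ*(e; B) = {e' ∈ E : (B \ e) ∪ e' is a basis}`, for `e ∈ B`. -/
def fundCocircuit (M : Matroid α) (B : Set α) (e : α) : Set α :=
  {e' | e' ∈ M.E ∧ M.IsBase (insert e' (B \ {e}))}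

/-- External activity: the number of `e ∈ E \ B` that are the minimum of their fundamental
circuit. -/
def externalActivity (M : Matroid α) (B : Set α) : ℕ :=
  {e | e ∈ M.E \ B ∧ IsLeast (fundCircuit M B e) e}.ncard

/-- Internal activity: the number of `e ∈ B` that are the minimum of their fundamental
cocircuit. -/
def internalActivity (M : Matroid α) (B : Set α) : ℕ :=
  {e | e ∈ B ∧ IsLeast (fundCocircuit M B e) e}.ncard

/-- The Tutte polynomial `T(M; x, y) = ∑_B x ^ in(B) * y ^ ex(B)`, the sum being over the bases of
`M`. The variable `x` is `X 0` and the variable `y` is `X 1`. -/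
def tuttePolynomial (M : Matroid α) : MvPolynomial (Fin 2) ℤ :=
  ∑ᶠ (B : Set α) (_ : M.IsBase B),
    MvPolynomial.X 0 ^ internalActivity M B * MvPolynomial.X 1 ^ externalActivity M B

/-- `t_{i,j}`, the coefficient of `x ^ i * y ^ j` in the Tutte polynomial. -/
def tutteCoeff (M : Matroid α) (i j : ℕ) : ℤ :=
  (tuttePolynomial M).coeff (Finsupp.single 0 i + Finsupp.single 1 j)

/-- Crapo's beta invariant `β(M) = t_{1,0}(M)`. -/
def betaInvariant (M : Matroid α) : ℤ := tutteCoeff M 1 0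

end Tutte

/-! ### Flags of flats and uniform matroids -/

/-- A proper flag of flats `∅ = F_0 ⊊ F_1 ⊊ ⋯ ⊊ F_ℓ = E` of length `ℓ`. -/
@[ext] structure ProperFlag {α : Type*} (M : Matroid α) (ℓ : ℕ) where
  /-- The flats of the flag. -/
  flat : Fin (ℓ + 1) → Set α
  isFlat : ∀ i, M.IsFlat (flat i)
  strictMono : StrictMono flat
  flat_zero : flat 0 = ∅
  flat_last : flat (Fin.last ℓ) = M.E

instance {α : Type*} [Finite α] (M : Matroid α) (ℓ : ℕ) : Finite (ProperFlag M ℓ) :=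
  Finite.of_injective ProperFlag.flat fun _ _ h => ProperFlag.ext h

/-- The uniform matroid of rank `r` on `α` (for `r ≤ |α|`): the independent sets are the sets with
at most `r` elements. -/
def uniformMatroid (α : Type*) [Finite α] (r : ℕ) : Matroid α :=
  (IndepMatroid.ofFinite (E := Set.univ) Set.finite_univ (fun I => I.ncard ≤ r)
    (by simp)
    (fun I J hJ hIJ => (Set.ncard_le_ncard hIJ (Set.toFinite J)).trans hJ)
    (by
      intro I J _ hJ hlt
      obtain ⟨e, heJ, heI⟩ := Set.exists_mem_notMem_of_ncard_lt_ncard hlt (Set.toFinite I)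
      exact ⟨e, heJ, heI, (Set.ncard_insert_le e I).trans (by omega)⟩)
    (fun _ _ => Set.subset_univ _)).matroid

/-! ### The ambient space and lattice -/

/-- The space `ℝ^α / ℝ·(1, …, 1)`, with its quotient topology. -/
abbrev Ambient (α : Type*) : Type _ := (α → ℝ) ⧸ (Submodule.span ℝ {(1 : α → ℝ)})

/-- The lattice `N = ℤ^α / ℤ·(1, …, 1)` inside `ℝ^α / ℝ·(1, …, 1)`. -/
def ambientLattice (α : Type*) : AddSubgroup (Ambient α) :=
  AddSubgroup.map
    (Submodule.mkQ (Submodule.span ℝ {(1 : α → ℝ)})).toAddMonoidHom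
    (AddMonoidHom.compLeft (Int.castAddHom ℝ) α).range

/-- The class of the indicator vector `e_F` of `F ⊆ α` in `ℝ^α / ℝ·(1, …, 1)`. -/
def indicatorVec {α : Type*} (F : Set α) : Ambient α :=
  Submodule.Quotient.mk (F.indicator 1)

/-! ### Weighted fans and stable intersection -/

/-- A finite collection of rational polyhedral cones in `ℝ^α / ℝ·(1, …, 1)`, indexed by their
dimension, with integer weights on the cones of dimension `dim`. The cones of a weighted fan of pure
dimension `dim` form such a collection. -/
structure WeightedFan.{u} (α : Type u) where
  /-- The labels of the cones of dimension `j`. -/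
  Idx : ℕ → Type u
  finite_idx : ∀ j, Finite (Idx j)
  /-- The cones of dimension `j`. -/
  cone : ∀ j, Idx j → PointedCone ℝ (Ambient α)
  rational : ∀ j i, ∃ s : Set (Ambient α), s.Finite ∧ s ⊆ ambientLattice α ∧
    cone j i = PointedCone.hull ℝ s
  finrank_span : ∀ j i, Module.finrank ℝ (Submodule.span ℝ (cone j i : Set (Ambient α))) = j
  /-- The dimension of the fan. -/
  dim : ℕ
  /-- The weights of the cones of top dimension. -/
  weight : Idx dim → ℤ

variable {α : Type*}

/-- The support of a fan: the union of its cones. -/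
def WeightedFan.support (T : WeightedFan α) : Set (Ambient α) :=
  ⋃ j ≤ T.dim, ⋃ i : T.Idx j, (T.cone j i : Set (Ambient α))

/-- For a cone `σ`, the lattice `N_σ` of lattice points in the linear span of `σ`. -/
def coneLattice (σ : PointedCone ℝ (Ambient α)) : AddSubgroup (Ambient α) :=
  ambientLattice α ⊓ (Submodule.span ℝ (σ : Set (Ambient α))).toAddSubgroup

/-- `σ ∩ (σ' + v) ≠ ∅`. -/
def Meets (σ σ' : PointedCone ℝ (Ambient α)) (v : Ambient α) : Prop :=
  ((σ : Set (Ambient α)) ∩ ((fun x => x + v) '' (σ' : Set (Ambient α)))).Nonempty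

/-- The perturbation `v` is generic for the fans `T` and `T'`: whenever a cone `σ` of `T` meets a
translate `σ' + v` of a cone of `T'`, they do so transversally, that is, the linear spans of `σ` and
`σ'` together span the ambient space. -/
def IsGeneric (T T' : WeightedFan α) (v : Ambient α) : Prop :=
  ∀ j ≤ T.dim, ∀ j' ≤ T'.dim, ∀ (i : T.Idx j) (i' : T'.Idx j'),
    Meets (T.cone j i) (T'.cone j' i') v →
      Submodule.span ℝ (T.cone j i : Set (Ambient α)) ⊔
        Submodule.span ℝ (T'.cone j' i' : Set (Ambient α)) = ⊤

/-- The support of the stable intersection, computed with the perturbation `v`: the limit of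
`|T| ∩ (|T'| + ε v)` as `ε → 0` from the right. -/
def stableSupport (T T' : WeightedFan α) (v : Ambient α) : Set (Ambient α) :=
  {p | ∃ x : ℝ → Ambient α,
    (∀ᶠ ε in nhdsWithin (0 : ℝ) (Set.Ioi 0),
      x ε ∈ T.support ∩ ((fun y => y + ε • v) '' T'.support)) ∧
    Filter.Tendsto x (nhdsWithin (0 : ℝ) (Set.Ioi 0)) (nhds p)}

open Classical in
/-- The weight of the stable intersection along `γ`, computed with the perturbation `v`:
`∑ c(σ) c'(σ') [N : N_σ + N_σ']`, the sum being over the pairs of top-dimensional cones `σ` of `T`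
and `σ'` of `T'` with `γ ⊆ σ`, `γ ⊆ σ'` and `σ ∩ (σ' + v) ≠ ∅`. -/
def stableWeight (T T' : WeightedFan α) (v : Ambient α) (γ : Set (Ambient α)) : ℤ :=
  ∑ᶠ p : T.Idx T.dim × T'.Idx T'.dim,
    if γ ⊆ T.cone T.dim p.1 ∧ γ ⊆ T'.cone T'.dim p.2 ∧
        Meets (T.cone T.dim p.1) (T'.cone T'.dim p.2) v then
      T.weight p.1 * T'.weight p.2 *
        ((coneLattice (T.cone T.dim p.1) ⊔ coneLattice (T'.cone T'.dim p.2)).relIndex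
          (ambientLattice α) : ℤ)
    else 0

/-! ### Bergman fans and Chern-Schwartz-MacPherson cycles -/

lemma flagVec_linearIndependent {M : Matroid α} {j : ℕ} (F : ProperFlag M (j + 1)) :
    LinearIndependent ℝ (fun i : Fin j => indicatorVec (F.flat i.castSucc.succ)) := by
  have hx : ∀ m : Fin (j + 1), ∃ x, x ∈ F.flat m.succ ∧ x ∉ F.flat m.castSucc := fun m =>
    Set.exists_of_ssubset (F.strictMono (Fin.castSucc_lt_succ (i := m)))
  choose x hx1 hx2 using hx
  rw [Fintype.linearIndependent_iff]
  intro g hg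
  have h1 : Submodule.Quotient.mk (p := Submodule.span ℝ {(1 : α → ℝ)})
      (∑ i : Fin j, g i • (F.flat i.castSucc.succ).indicator (1 : α → ℝ)) = 0 := by
    rw [← hg, ← Submodule.mkQ_apply, map_sum]
    rfl
  rw [Submodule.Quotient.mk_eq_zero, Submodule.mem_span_singleton] at h1
  obtain ⟨c, hc⟩ := h1
  have key : ∀ m : Fin (j + 1), c = ∑ i : Fin j, if m.val ≤ i.val then g i else 0 := by
    intro m
    have h2 := congrFun hc (x m)
    simp only [Pi.smul_apply, Pi.one_apply, smul_eq_mul, mul_one, Finset.sum_apply] at h2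
    rw [h2]
    refine Finset.sum_congr rfl fun i _ => ?_
    split_ifs with hmi
    · have : x m ∈ F.flat i.castSucc.succ :=
        F.strictMono.monotone (by rw [Fin.le_def]; simpa using hmi) (hx1 m)
      rw [Set.indicator_of_mem this]; simp
    · have : x m ∉ F.flat i.castSucc.succ := fun h =>
        hx2 m (F.strictMono.monotone (by rw [Fin.le_def]; simp; omega) h)
      rw [Set.indicator_of_notMem this]; simp
  intro i
  have e1 := key i.castSucc
  have e2 := key i.succ
  have e3 : (∑ l : Fin j, if i.castSucc.val ≤ l.val then g l else 0) =
      (∑ l : Fin j, if i.succ.val ≤ l.val then g l else 0) +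
        ∑ l : Fin j, if l = i then g l else 0 := by
    rw [← Finset.sum_add_distrib]
    refine Finset.sum_congr rfl fun l _ => ?_
    by_cases hl : l = i
    · subst hl; simp
    · have : l.val ≠ i.val := fun h => hl (Fin.ext h)
      by_cases h : i.val ≤ l.val
      · have h' : i.val + 1 ≤ l.val := by omega
        simp [hl, h, h']
      · have h' : ¬ i.val + 1 ≤ l.val := by omega
        simp [hl, h, h']
  rw [← e1, ← e2] at e3
  simpa using e3

lemma finrank_span_hull_range {j : ℕ} {f : Fin j → Ambient α} (hf : LinearIndependent ℝ f) :
    Module.finrank ℝ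
      (Submodule.span ℝ (PointedCone.hull ℝ (Set.range f) : Set (Ambient α))) = j := by
  have : Submodule.span ℝ (PointedCone.hull ℝ (Set.range f) : Set (Ambient α)) =
      Submodule.span ℝ (Set.range f) := Submodule.span_span_of_tower _ _ _
  rw [this, finrank_span_eq_card hf, Fintype.card_fin]

lemma indicatorVec_mem (F : Set α) : indicatorVec F ∈ ambientLattice α := by
  refine ⟨F.indicator 1, ⟨F.indicator 1, ?_⟩, rfl⟩
  ext i
  by_cases h : i ∈ F <;> simp [h]

/-- The cone `σ_F` spanned by `e_{F_1}, …, e_{F_j}` in `ℝ^α / ℝ·(1, …, 1)`, for a proper flag of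
flats `∅ = F_0 ⊊ F_1 ⊊ ⋯ ⊊ F_j ⊊ F_{j+1} = E`. -/
def flagCone {M : Matroid α} {j : ℕ} (F : ProperFlag M (j + 1)) : PointedCone ℝ (Ambient α) :=
  PointedCone.hull ℝ (Set.range fun i : Fin j => indicatorVec (F.flat i.castSucc.succ))

/-- The fan of the cones `σ_F` of all proper flags of flats `F` of `M`, as a fan of dimension `k`
(only the cones of dimension at most `k` are used) with given weights on the cones of
dimension `k`. -/
def skeleton [Finite α] (M : Matroid α) (k : ℕ) (w : ProperFlag M (k + 1) → ℤ) :
    WeightedFan α where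
  Idx j := ProperFlag M (j + 1)
  finite_idx _ := inferInstance
  cone _ F := flagCone F
  rational _ F := ⟨_, Set.finite_range _, by rintro _ ⟨i, rfl⟩; exact indicatorVec_mem _, rfl⟩
  finrank_span _ F := finrank_span_hull_range (flagVec_linearIndependent F)
  dim := k
  weight := w

/-- The Bergman fan of `M`, of dimension `rk M - 1`, with all weights equal to `1`. -/
def bergmanFan [Finite α] (M : Matroid α) : WeightedFan α :=
  skeleton M (M.eRank.toNat - 1) fun _ => 1

/-- The `k`-th Chern-Schwartz-MacPherson cycle of a matroid of rank `d + 1`: the `k`-skeleton of the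
Bergman fan, the cone of `∅ = F_0 ⊊ F_1 ⊊ ⋯ ⊊ F_{k+1} = E` having the weight
`(-1) ^ (d - k) * ∏_{i = 0}^{k} β(M|F_{i+1}/F_i)`. -/
def csmCycle [Finite α] [LinearOrder α] (M : Matroid α) (k : ℕ) : WeightedFan α :=
  skeleton M k fun F =>
    (-1) ^ (M.eRank.toNat - 1 - k) *
      ∏ i : Fin (k + 1), betaInvariant ((M ↾ F.flat i.succ) ／ F.flat i.castSucc)

/-! ### The degree -/

/-- For a cycle `T` of dimension `k` in `ℝ^(n+1) / ℝ·(1, …, 1)`, the Bergman fan of complementary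
dimension `n - k` of a uniform matroid, namely the one of rank `n - k + 1` on `n + 1` elements. -/
def complementaryFan [Finite α] (T : WeightedFan α) : WeightedFan α :=
  bergmanFan (uniformMatroid α (Nat.card α - T.dim))

/-- The degree of `T`, computed with the perturbation `v`: the sum of the weights of the points in
the support of the stable intersection of `T` with the Bergman fan of complementary dimension of a
uniform matroid. -/
def degree [Finite α] (T : WeightedFan α) (v : Ambient α) : ℤ :=
  ∑ᶠ (p : Ambient α) (_ : p ∈ stableSupport T (complementaryFan T) v),
    stableWeight T (complementaryFan T) v {p}

end CSM

end

/-!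
The degree is computed in two independent steps, a geometric count and an identity of Tutte
coefficients.

*Geometry.* Let `v` be the class of `w : α → ℝ`, let `F` be a flag of `k + 1` steps of `M`, and let
`G` be a flag of maximal length of the uniform matroid. A point of the cone of `F` is a function `x`
that is constant on the blocks `F_{i+1} \ F_i` and decreases with `i`
(`toAmbient_mem_flagCone_iff`), and `x - w` lies in the fan of the uniform matroid when its minimum
is attained on at least `k + 1` elements. Transversality forces exactly one of these elements into
each block (`exists_block_eq_of_span_sup_eq_top`); hence the value of `x` on a block is, up to a
common constant, the maximum of `w` there. So the cone of `F` meets a translated cone `σ_G + v`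
exactly when these maxima decrease along the blocks, that is, when each `F_{i+1}` contains the
maximizer of `w` on the complement of `F_i`, and then `G` is unique (`mem_flat_of_meets`,
`exists_meets`, `eq_of_meets`). The lattice index is `1` (`coneLattice_sup_eq`). Since the
intersections `|T| ∩ (|T'| + εv)` are the multiples by `ε` of a finite set, the stable intersection
is supported at the origin. Thus the degree is the sum of the weights of the flags `F` with the
above property (`stableWeight_skeleton`).

*Combinatorics.* It remains to see that, for any choice of an element `e A` outside each proper
subset `A`, the sum of `∏ β(M|F_{i+1}/F_i)` over the flags with `e F_i ∈ F_{i+1}` is `t_{k+1,0}(M)`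
(`tutteCoeff_eq_sum_flags`). This follows by iterating the convolution formula
`T_M(x, 0) = x ∑_{F ∋ e} β(M|F) T_{M/F}(x, 0)`, for any fixed element `e` of a loopless matroid
(`intervalPoly_eq_sum`). For the corank-nullity form of `T(x, 0)` the formula is a Möbius inversion
in the lattice of all subsets, because the terms at the sets `F` that are not flats vanish. The
corank-nullity form agrees with the one by activities since both satisfy the recursion by deletion
and contraction of the largest element (`activityPoly_eq_intervalPoly`); in particular the latter
does not depend on the order, which is why the order may be replaced by the one given by `w`.
-/

open scoped Matroid

namespace CSM

/-! ### Alternating sums over intervals of finite sets -/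

section Intervals

open Finset

variable {α : Type*} [DecidableEq α]

lemma sum_Icc_insert {β : Type*} [AddCommMonoid β] {e : α} {A B : Finset α} (heA : e ∉ A)
    (heB : e ∈ B) (f : Finset α → β) :
    ∑ C ∈ Icc (insert e A) B, f C = ∑ C ∈ Icc A (B.erase e), f (insert e C) := by
  refine sum_nbij' (fun C => C.erase e) (fun C => insert e C) ?_ ?_ ?_ ?_ ?_
  · intro C hC
    simp only [mem_Icc] at hC ⊢
    refine ⟨?_, erase_subset_erase e hC.2⟩
    rw [← erase_insert heA]
    exact erase_subset_erase e hC.1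
  · intro C hC
    simp only [mem_Icc] at hC ⊢
    exact ⟨insert_subset_insert e hC.1, insert_subset heB (hC.2.trans (erase_subset e B))⟩
  · intro C hC
    simp only [mem_Icc] at hC
    exact insert_erase (hC.1 (mem_insert_self e A))
  · intro C hC
    simp only [mem_Icc] at hC
    exact erase_insert fun h => notMem_erase e B (hC.2 h)
  · intro C hC
    simp only [mem_Icc] at hC
    rw [insert_erase (hC.1 (mem_insert_self e A))]

lemma sum_Icc_split {β : Type*} [AddCommMonoid β] (e : α) (A B : Finset α)
    (f : Finset α → β) :
    ∑ C ∈ Icc A B, f C =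
      ∑ C ∈ Icc A (B.erase e), f C + ∑ C ∈ Icc (insert e A) B, f C := by
  rw [← sum_filter_not_add_sum_filter _ (fun C => e ∈ C)]
  congr 1
  · refine sum_congr ?_ fun _ _ => rfl
    ext C
    simp only [mem_filter, mem_Icc, subset_erase]
    tauto
  · refine sum_congr ?_ fun _ _ => rfl
    ext C
    simp only [mem_filter, mem_Icc, insert_subset_iff]
    tauto

lemma sum_Icc_pair {β : Type*} [AddCommMonoid β] {e : α} {A B : Finset α}
    (heA : e ∉ A) (heB : e ∈ B) (f : Finset α → β) :
    ∑ C ∈ Icc A B, f C = ∑ C ∈ Icc A (B.erase e), (f C + f (insert e C)) := by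
  rw [sum_Icc_split e A B, sum_Icc_insert heA heB, sum_add_distrib]

lemma sum_Icc_neg_one_pow_card {R : Type*} [Ring R] (A B : Finset α) :
    ∑ C ∈ Icc A B, (-1 : R) ^ #C = if A = B then (-1 : R) ^ #B else 0 := by
  split_ifs with h
  · subst h; simp
  · by_cases hAB : A ⊆ B
    · obtain ⟨e, heB, heA⟩ := exists_of_ssubset (hAB.ssubset_of_ne h)
      rw [sum_Icc_pair heA heB]
      refine sum_eq_zero fun C hC => ?_
      simp only [mem_Icc] at hC
      rw [card_insert_of_notMem fun h => notMem_erase e B (hC.2 h), pow_succ]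
      simp
    · rw [Icc_eq_empty (by simpa using hAB), sum_empty]

end Intervals

/-! ### Rank functions and the polynomial of an interval -/

section RankFunction

open Finset Polynomial

variable {α : Type*} [DecidableEq α]

/-- The properties of the rank function of a matroid on finite sets that are used here; the last
one says that an element spanned by `A` is spanned by every larger set. -/
structure IsRankFunction (r : Finset α → ℕ) : Prop where
  mono : Monotone r
  insert_le : ∀ e A, r (insert e A) ≤ r A + 1
  insert_eq : ∀ {e A C}, A ⊆ C → r (insert e A) = r A → r (insert e C) = r C

/-- The specialization `T(x, 0)` of the Tutte polynomial of the minor `M|B/A` of a matroid `M` with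
rank function `r`, in its corank-nullity form
`∑_{A ⊆ C ⊆ B} (x - 1) ^ (r B - r C) * (-1) ^ (|C \ A| - (r C - r A))`.
The signs are arranged so that no subtraction besides `r B - r C` occurs. -/
noncomputable def intervalPoly (r : Finset α → ℕ) (A B : Finset α) : ℤ[X] :=
  (-1) ^ (r A + r B + #A) * ∑ C ∈ Icc A B, (-1) ^ #C * (1 - X) ^ (r B - r C)

lemma neg_one_pow_mul_self {R : Type*} [Ring R] (n : ℕ) : (-1 : R) ^ n * (-1) ^ n = 1 := by
  rw [← pow_add, ← two_mul]; simp

lemma intervalPoly_self (r : Finset α → ℕ) (A : Finset α) : intervalPoly r A A = 1 := by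
  simp only [intervalPoly, Icc_self, sum_singleton, Nat.sub_self, pow_zero, mul_one]
  rw [← two_mul, pow_add, pow_mul, mul_assoc, neg_one_pow_mul_self]; simp

lemma coeff_one_one_sub_X_pow (n : ℕ) : ((1 - X : ℤ[X]) ^ n).coeff 1 = -n := by
  induction n with
  | zero => simp [coeff_one]
  | succ n ih =>
    have h0 : ((1 - X : ℤ[X]) ^ n).coeff 0 = 1 := by
      simp [coeff_zero_eq_eval_zero]
    rw [pow_succ, mul_sub, coeff_sub, mul_one, coeff_mul_X, ih, h0]; push_cast; ring

lemma neg_one_pow_eq_C (n : ℕ) : (-1 : ℤ[X]) ^ n = C ((-1) ^ n) := by simp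

lemma coeff_one_intervalPoly {r : Finset α → ℕ} {A B : Finset α} (h : A ≠ B)
    (hr : Monotone r) :
    (intervalPoly r A B).coeff 1 =
      (-1) ^ (r A + r B + #A) * ∑ C ∈ Icc A B, (-1) ^ #C * (r C : ℤ) := by
  have key : ∑ C ∈ Icc A B, (-1 : ℤ) ^ #C * (r B : ℤ) = 0 := by
    rw [← sum_mul, sum_Icc_neg_one_pow_card, if_neg h, zero_mul]
  rw [intervalPoly, neg_one_pow_eq_C, coeff_C_mul, finsetSum_coeff]
  congr 1
  calc ∑ C ∈ Icc A B, ((-1 : ℤ[X]) ^ #C * (1 - X) ^ (r B - r C)).coeff 1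
      = ∑ C ∈ Icc A B, ((-1) ^ #C * (r C : ℤ) - (-1) ^ #C * (r B : ℤ)) := by
        refine sum_congr rfl fun C hC => ?_
        rw [neg_one_pow_eq_C, coeff_C_mul, coeff_one_one_sub_X_pow,
          Nat.cast_sub (hr (mem_Icc.1 hC).2)]
        ring
    _ = _ := by rw [sum_sub_distrib, key, sub_zero]

/-- Möbius inversion: summing `(-1) ^ |B|` times the alternating sum of `r` over `[A, B]` leaves
only the last increment of `r` at `e`. -/
lemma sum_neg_one_pow_mul_alternating (r : Finset α → ℤ) {e : α} {A C : Finset α} (heA : e ∉ A)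
    (hC : insert e A ⊆ C) :
    ∑ B ∈ Icc (insert e A) C, (-1 : ℤ) ^ #B * ∑ D ∈ Icc A B, (-1 : ℤ) ^ #D * r D =
      r C - r (C.erase e) := by
  have heC : e ∈ C := hC (mem_insert_self e A)
  have hAC : A ⊆ C.erase e := fun a ha =>
    mem_erase.2 ⟨fun h => heA (h ▸ ha), hC (mem_insert_of_mem ha)⟩
  have h1 : ∑ B ∈ Icc (insert e A) C, (-1 : ℤ) ^ #B * ∑ D ∈ Icc A B, (-1 : ℤ) ^ #D * r D =
      ∑ D ∈ Icc A C, (-1 : ℤ) ^ #D * r D * ∑ B ∈ Icc (insert e D) C, (-1 : ℤ) ^ #B := by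
    simp_rw [mul_sum]
    rw [sum_comm' (t' := Icc A C) (s' := fun D => Icc (insert e D) C)]
    · exact sum_congr rfl fun D _ => sum_congr rfl fun B _ => by ring
    · intro B D
      simp only [mem_Icc, insert_subset_iff]
      constructor
      · rintro ⟨⟨⟨h1, h2⟩, h3⟩, h4, h5⟩
        exact ⟨⟨⟨h1, h5⟩, h3⟩, h4, h5.trans h3⟩
      · rintro ⟨⟨⟨h1, h5⟩, h3⟩, h4, h6⟩
        exact ⟨⟨⟨h1, h4.trans h5⟩, h3⟩, h4, h5⟩
  rw [h1, sum_Icc_pair heA heC]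
  rw [sum_eq_single (C.erase e)]
  · simp only [sum_Icc_neg_one_pow_card, insert_erase heC, insert_eq_of_mem heC, if_true]
    have hc : #C = #(C.erase e) + 1 := (card_erase_add_one heC).symm
    rw [hc, pow_succ]
    linear_combination (r C - r (C.erase e)) * neg_one_pow_mul_self (R := ℤ) #(C.erase e)
  · intro D hD hne
    have heD : e ∉ D := fun h => notMem_erase e C ((mem_Icc.1 hD).2 h)
    have : insert e D ≠ C := fun h => hne (by rw [← h, erase_insert heD])
    simp [sum_Icc_neg_one_pow_card, this]
  · intro h; exact absurd (mem_Icc.2 ⟨hAC, le_rfl⟩) h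

/-- The polynomial of `[A, U]` is a convolution over the sets `B` containing `A` and a fixed further
element `e`: for a loopless matroid, `T_M(x, 0) = x ∑_{F ∋ e} β(M|F) T_{M/F}(x, 0)`. -/
theorem intervalPoly_eq_sum {r : Finset α → ℕ} (hr : IsRankFunction r) {e : α} {A U : Finset α}
    (heA : e ∉ A) (heU : e ∈ U) :
    intervalPoly r A U =
      X * ∑ B ∈ Icc (insert e A) U, C ((intervalPoly r A B).coeff 1) * intervalPoly r B U := by
  have hne : ∀ B ∈ Icc (insert e A) U, A ≠ B := fun B hB h =>
    heA (h ▸ (mem_Icc.1 hB).1 (mem_insert_self e A))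
  have h1 : ∑ B ∈ Icc (insert e A) U, C ((intervalPoly r A B).coeff 1) * intervalPoly r B U =
      (-1) ^ (r A + r U + #A) * ∑ D ∈ Icc (insert e A) U,
        (-1) ^ #D * (1 - X) ^ (r U - r D) * C ((r D : ℤ) - r (D.erase e)) := by
    calc _ = ∑ B ∈ Icc (insert e A) U, ∑ D ∈ Icc B U, (-1) ^ (r A + r U + #A) *
          ((-1) ^ #D * (1 - X) ^ (r U - r D) *
            C ((-1) ^ #B * ∑ D ∈ Icc A B, (-1) ^ #D * (r D : ℤ))) := by
          refine sum_congr rfl fun B hB => ?_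
          rw [coeff_one_intervalPoly (hne B hB) hr.mono, intervalPoly]
          generalize ∑ C ∈ Icc A B, (-1) ^ #C * (r C : ℤ) = b
          rw [mul_sum, mul_sum]
          refine sum_congr rfl fun D _ => ?_
          simp only [C_mul, ← neg_one_pow_eq_C, pow_add]
          linear_combination ((-1) ^ r A * (-1) ^ #A *
            C b * (-1) ^ r U * (-1) ^ #B *
            ((-1) ^ #D * (1 - X) ^ (r U - r D))) * neg_one_pow_mul_self (R := ℤ[X]) (r B)
      _ = ∑ D ∈ Icc (insert e A) U, ∑ B ∈ Icc (insert e A) D, (-1) ^ (r A + r U + #A) *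
          ((-1) ^ #D * (1 - X) ^ (r U - r D) *
            C ((-1) ^ #B * ∑ D ∈ Icc A B, (-1) ^ #D * (r D : ℤ))) := by
          refine sum_comm' (fun B D => ?_)
          simp only [mem_Icc]
          constructor
          · rintro ⟨⟨a, b⟩, c, d⟩; exact ⟨⟨a, c⟩, a.trans c, d⟩
          · rintro ⟨⟨a, b⟩, c, d⟩; exact ⟨⟨a, b.trans d⟩, b, d⟩
      _ = _ := by
          rw [mul_sum]
          refine sum_congr rfl fun D hD => ?_
          rw [← mul_sum, ← mul_sum, ← map_sum,
            sum_neg_one_pow_mul_alternating (fun D => (r D : ℤ)) heA (mem_Icc.1 hD).1]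
  rw [h1, intervalPoly, sum_Icc_pair heA heU, sum_Icc_insert heA heU, mul_left_comm X,
    mul_sum _ _ (X : ℤ[X])]
  congr 1
  refine sum_congr rfl fun D hD => ?_
  have heD : e ∉ D := fun h => notMem_erase e U ((mem_Icc.1 hD).2 h)
  have hDU : insert e D ⊆ U :=
    insert_subset heU ((mem_Icc.1 hD).2.trans (erase_subset e U))
  rw [erase_insert heD, card_insert_of_notMem heD]
  have a1 : r D ≤ r (insert e D) := hr.mono (subset_insert e D)
  have a2 := hr.insert_le e D
  have a3 := hr.mono hDU
  obtain h | h : r (insert e D) = r D ∨ r (insert e D) = r D + 1 := by omega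
  · rw [h]; simp [pow_succ]
  · have : r U - r D = (r U - r (insert e D)) + 1 := by omega
    rw [this, h]; push_cast; simp only [add_sub_cancel_left, C_1]; ring

/-- If `M/A` has a loop `e`, then the terms of `C` and `C ∪ e` cancel. -/
lemma intervalPoly_eq_zero {r : Finset α → ℕ} (hr : IsRankFunction r) {e : α} {A U : Finset α}
    (heA : e ∉ A) (heU : e ∈ U) (h : r (insert e A) = r A) : intervalPoly r A U = 0 := by
  rw [intervalPoly, sum_Icc_pair heA heU, sum_eq_zero, mul_zero]
  intro D hD
  have heD : e ∉ D := fun h => notMem_erase e U ((mem_Icc.1 hD).2 h)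
  rw [hr.insert_eq (mem_Icc.1 hD).1 h, card_insert_of_notMem heD]
  ring

/-- An element `e` that is a coloop of `M|G` increases the rank of every subset of `G \ e`. -/
lemma IsRankFunction.insert_eq_add_one {r : Finset α → ℕ} (hr : IsRankFunction r) {e : α}
    {C G : Finset α} (hCG : C ⊆ G.erase e) (heG : e ∈ G) (h : r (G.erase e) ≠ r G) :
    r (insert e C) = r C + 1 := by
  have a1 : r C ≤ r (insert e C) := hr.mono (subset_insert e C)
  have a2 := hr.insert_le e C
  have a3 : r (insert e C) ≠ r C := fun h' => h (by
    have := hr.insert_eq hCG h'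
    rw [insert_erase heG] at this; exact this.symm)
  omega

lemma intervalPoly_coloop {r : Finset α → ℕ} (hr : IsRankFunction r) {e : α} {F G : Finset α}
    (heF : e ∉ F) (heG : e ∈ G) (hFG : F ⊆ G) (h : r (G.erase e) ≠ r G) :
    intervalPoly r F G = X * intervalPoly r (insert e F) G := by
  have hF : F ⊆ G.erase e := subset_erase.2 ⟨hFG, heF⟩
  rw [intervalPoly, intervalPoly, sum_Icc_pair heF heG, sum_Icc_insert heF heG,
    hr.insert_eq_add_one hF heG h, card_insert_of_notMem heF, mul_left_comm, mul_sum _ _ (X : ℤ[X]),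
    mul_sum, mul_sum]
  refine sum_congr rfl fun D hD => ?_
  have heD : e ∉ D := fun h => notMem_erase e G ((mem_Icc.1 hD).2 h)
  have a1 := hr.insert_eq_add_one (mem_Icc.1 hD).2 heG h
  have a2 : r (insert e D) ≤ r G :=
    hr.mono (insert_subset heG ((mem_Icc.1 hD).2.trans (erase_subset e G)))
  have : r G - r D = (r G - r (insert e D)) + 1 := by omega
  rw [this, card_insert_of_notMem heD]
  ring

lemma intervalPoly_deletion_contraction {r : Finset α → ℕ} {e : α}
    {F G : Finset α} (heF : e ∉ F) (h : r (G.erase e) = r G)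
    (h' : r (insert e F) = r F + 1) :
    intervalPoly r F G = intervalPoly r F (G.erase e) + intervalPoly r (insert e F) G := by
  rw [intervalPoly, intervalPoly, intervalPoly, sum_Icc_split e F G, h, h',
    card_insert_of_notMem heF]
  ring

end RankFunction

/-! ### Activities of bases of minors -/

section RankFunctionLemmas

open Finset

variable {α : Type*} [DecidableEq α] {r : Finset α → ℕ}

lemma IsRankFunction.union_le (hr : IsRankFunction r) (B F : Finset α) :
    r (B ∪ F) ≤ #B + r F := by
  induction B using Finset.induction_on with
  | empty => simp
  | insert a s ha ih =>
    rw [insert_union, card_insert_of_notMem ha]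
    have := hr.insert_le a (s ∪ F)
    omega

lemma IsRankFunction.union_eq (hr : IsRankFunction r) {S A : Finset α}
    (h : ∀ f ∈ S, r (insert f A) = r A) : r (S ∪ A) = r A := by
  induction S using Finset.induction_on with
  | empty => simp
  | insert a s ha ih =>
    rw [insert_union, hr.insert_eq subset_union_right (h a (mem_insert_self a s)),
      ih fun f hf => h f (mem_insert_of_mem hf)]

/-- If `e` is spanned by `A ∪ F` but not by `F`, where `A ⊆ B`, then `e` may be exchanged for an
element of `B` without changing the span of `B ∪ F ∪ e`. -/
lemma IsRankFunction.exists_exchange (hr : IsRankFunction r) {e : α} {A B F : Finset α}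
    (heB : e ∉ B) (he : r (insert e F) ≠ r F) (hAB : A ⊆ B)
    (hA : r (insert e (A ∪ F)) = r (A ∪ F)) :
    ∃ f ∈ B, r ((insert e B).erase f ∪ F) = r (insert e (B ∪ F)) := by
  induction A using Finset.induction_on with
  | empty => exact absurd (by simpa using hA) he
  | insert f s hf ih =>
    have hfB : f ∈ B := hAB (mem_insert_self f s)
    have hsB : s ⊆ B := (subset_insert f s).trans hAB
    by_cases h : r (insert e (s ∪ F)) = r (s ∪ F)
    · exact ih hsB h
    · refine ⟨f, hfB, ?_⟩
      rw [insert_union] at hA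
      have a1 : r (s ∪ F) ≤ r (insert e (s ∪ F)) := hr.mono (subset_insert _ _)
      have a2 := hr.insert_le f (s ∪ F)
      have a3 : r (insert e (s ∪ F)) ≤ r (insert f (insert e (s ∪ F))) :=
        hr.mono (subset_insert _ _)
      rw [insert_comm] at hA
      have a4 : r (insert f (insert e (s ∪ F))) = r (insert e (s ∪ F)) := by omega
      have hef : f ≠ e := fun h => heB (h ▸ hfB)
      have hsub : insert e (s ∪ F) ⊆ (insert e B).erase f ∪ F := by
        intro x hx
        simp only [mem_insert, mem_union, mem_erase] at hx ⊢
        rcases hx with rfl | hx | hx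
        · exact Or.inl ⟨hef.symm, Or.inl rfl⟩
        · exact Or.inl ⟨fun h => hf (h ▸ hx), Or.inr (hsB hx)⟩
        · exact Or.inr hx
      rw [← hr.insert_eq hsub a4, ← insert_union, insert_erase (mem_insert_of_mem hfB),
        insert_union]

end RankFunctionLemmas

section MinorBase

open Finset Polynomial

variable {α : Type*} [DecidableEq α]

/-- `B` is a basis of the minor `M|G/F` of a matroid `M` with rank function `r`. -/
def IsMinorBase (r : Finset α → ℕ) (F G B : Finset α) : Prop :=
  B ⊆ G \ F ∧ #B + r F = r G ∧ r (B ∪ F) = r G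

lemma isMinorBase_insert_iff {r : Finset α → ℕ} {e : α} {F G B : Finset α} (heF : e ∉ F)
    (heG : e ∈ G) (heB : e ∉ B) (h : r (insert e F) = r F + 1) :
    IsMinorBase r F G (insert e B) ↔ IsMinorBase r (insert e F) G B := by
  have h1 : insert e B ⊆ G \ F ↔ B ⊆ G \ insert e F := by
    constructor
    · intro hs x hx
      have := mem_sdiff.1 (hs (mem_insert_of_mem hx))
      refine mem_sdiff.2 ⟨this.1, fun hx' => ?_⟩
      rcases mem_insert.1 hx' with rfl | hx'
      · exact heB hx
      · exact this.2 hx'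
    · intro hs x hx
      rcases mem_insert.1 hx with rfl | hx
      · exact mem_sdiff.2 ⟨heG, heF⟩
      · have := mem_sdiff.1 (hs hx)
        exact mem_sdiff.2 ⟨this.1, fun hx' => this.2 (mem_insert_of_mem hx')⟩
  unfold IsMinorBase
  rw [h1, card_insert_of_notMem heB, h, insert_union, union_insert,
    show #B + 1 + r F = #B + (r F + 1) by ring]

lemma isMinorBase_erase_iff {r : Finset α → ℕ} {e : α} {F G B : Finset α}
    (heB : e ∉ B) (h : r (G.erase e) = r G) :
    IsMinorBase r F (G.erase e) B ↔ IsMinorBase r F G B := by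
  have h1 : B ⊆ G.erase e \ F ↔ B ⊆ G \ F := by
    rw [erase_sdiff_comm, subset_erase, and_iff_left heB]
  unfold IsMinorBase
  rw [h1, h]

lemma IsMinorBase.mem_of_coloop {r : Finset α → ℕ} (hr : IsRankFunction r) {e : α}
    {F G B : Finset α} (heF : e ∉ F) (hFG : F ⊆ G) (h : r (G.erase e) ≠ r G)
    (hB : IsMinorBase r F G B) : e ∈ B := by
  by_contra heB
  have h1 : B ∪ F ⊆ G.erase e :=
    union_subset (subset_erase.2 ⟨hB.1.trans sdiff_subset, heB⟩) (subset_erase.2 ⟨hFG, heF⟩)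
  have h2 := hr.mono h1
  have h3 : r (G.erase e) ≤ r G := hr.mono (erase_subset e G)
  rw [hB.2.2] at h2
  omega


end MinorBase

section Activity

open Finset Polynomial

variable {α : Type*} [LinearOrder α]

/-- No element of `G \ F` outside the basis `B` of `M|G/F` is externally active. -/
def NoExternal (r : Finset α → ℕ) (F G B : Finset α) : Prop :=
  ∀ e ∈ (G \ F) \ B, ∃ f < e, IsMinorBase r F G ((insert e B).erase f)

open Classical in
/-- The internally active elements of the basis `B` of `M|G/F`. -/
noncomputable def internalActive (r : Finset α → ℕ) (F G B : Finset α) : Finset α :=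
  B.filter fun e => ∀ f < e, ¬ IsMinorBase r F G (insert f (B.erase e))

open Classical in
/-- The bases of `M|G/F` of external activity zero. -/
noncomputable def noExternalBases (r : Finset α → ℕ) (F G : Finset α) : Finset (Finset α) :=
  (G \ F).powerset.filter fun B => IsMinorBase r F G B ∧ NoExternal r F G B

lemma mem_noExternalBases {r : Finset α → ℕ} {F G B : Finset α} :
    B ∈ noExternalBases r F G ↔ IsMinorBase r F G B ∧ NoExternal r F G B := by
  simp only [noExternalBases, mem_filter, mem_powerset, and_iff_right_iff_imp]
  exact fun h => h.1.1

/-- The generating function of the internal activities of the bases of external activity zero of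
the minor `M|G/F`. -/
noncomputable def activityPoly (r : Finset α → ℕ) (F G : Finset α) : ℤ[X] :=
  ∑ B ∈ noExternalBases r F G, X ^ #(internalActive r F G B)

lemma activityPoly_self (r : Finset α → ℕ) (F : Finset α) : activityPoly r F F = 1 := by
  have : noExternalBases r F F = {∅} := by
    ext B
    rw [mem_noExternalBases, mem_singleton]
    constructor
    · rintro ⟨h, -⟩
      simpa using h.1
    · rintro rfl
      exact ⟨⟨by simp, by simp, by simp⟩, by intro e; simp⟩
  rw [activityPoly, this, sum_singleton, internalActive, filter_empty, card_empty, pow_zero]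

lemma noExternalBases_loop {r : Finset α → ℕ} (hr : IsRankFunction r) {e : α}
    {F G : Finset α} (heF : e ∉ F) (heG : e ∈ G) (h : r (insert e F) = r F) :
    noExternalBases r F G = ∅ := by
  refine eq_empty_of_forall_notMem fun B hB => ?_
  obtain ⟨hB, hex⟩ := mem_noExternalBases.1 hB
  -- A basis cannot contain the loop `e`.
  have hloop : ∀ B, IsMinorBase r F G B → e ∉ B := by
    intro B hB heB
    have h1 := hr.union_le (B.erase e) F
    have h2 : r (insert e (B.erase e ∪ F)) = r (B.erase e ∪ F) :=
      hr.insert_eq subset_union_right h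
    rw [← insert_union, insert_erase heB, hB.2.2] at h2
    have h3 := card_erase_add_one heB
    have h4 := hB.2.1
    omega
  obtain ⟨f, hfe, hf⟩ := hex e (mem_sdiff.2 ⟨mem_sdiff.2 ⟨heG, heF⟩, hloop B hB⟩)
  exact hloop _ hf (mem_erase.2 ⟨hfe.ne', mem_insert_self e B⟩)

section Recursion

variable {r : Finset α → ℕ} {e : α} {F G : Finset α}

lemma insert_mem_noExternalBases_iff (heF : e ∉ F) (heG : e ∈ G)
    (hmax : ∀ x ∈ G \ F, x ≤ e) (h : r (insert e F) = r F + 1) {B : Finset α} (heB : e ∉ B) :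
    insert e B ∈ noExternalBases r F G ↔ B ∈ noExternalBases r (insert e F) G := by
  rw [mem_noExternalBases, mem_noExternalBases, isMinorBase_insert_iff heF heG heB h]
  refine and_congr_right fun _ => ?_
  have hset : (G \ F) \ insert e B = (G \ insert e F) \ B := by
    ext x; simp only [mem_sdiff, mem_insert]; tauto
  unfold NoExternal
  rw [hset]
  refine forall₂_congr fun x hx => exists_congr fun f => and_congr_right fun hf => ?_
  have hxe : x ≠ e := by rintro rfl; simp at hx
  have hfe : f ≠ e := by
    rintro rfl
    have hx' := mem_sdiff.1 (mem_sdiff.1 hx).1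
    exact absurd (hmax x (mem_sdiff.2 ⟨hx'.1, fun h => hx'.2 (mem_insert_of_mem h)⟩))
      (not_le.2 hf)
  rw [insert_comm, erase_insert_of_ne hfe.symm, isMinorBase_insert_iff heF heG _ h]
  simp [hxe.symm, heB]

lemma mem_noExternalBases_erase_iff (hr : IsRankFunction r) (heF : e ∉ F) (heG : e ∈ G)
    (hFG : F ⊆ G) (hmax : ∀ x ∈ G \ F, x ≤ e)
    (h : r (insert e F) = r F + 1) (h' : r (G.erase e) = r G) {B : Finset α} (heB : e ∉ B) :
    B ∈ noExternalBases r F G ↔ B ∈ noExternalBases r F (G.erase e) := by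
  rw [mem_noExternalBases, mem_noExternalBases, isMinorBase_erase_iff heB h']
  refine and_congr_right fun hB => ?_
  have haux : ∀ x ∈ (G.erase e \ F) \ B, ∀ f,
      IsMinorBase r F (G.erase e) ((insert x B).erase f) ↔
        IsMinorBase r F G ((insert x B).erase f) := by
    intro x hx f
    refine isMinorBase_erase_iff ?_ h'
    have hxe : x ≠ e := by rintro rfl; simp at hx
    simp [hxe.symm, heB]
  constructor
  · intro hex x hx
    have hx' : x ∈ (G \ F) \ B :=
      sdiff_subset_sdiff (sdiff_subset_sdiff (erase_subset e G) le_rfl) le_rfl hx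
    obtain ⟨f, hf, hfB⟩ := hex x hx'
    exact ⟨f, hf, (haux x hx f).2 hfB⟩
  · intro hex x hx
    by_cases hxe : x = e
    · -- The element `e` is spanned by `B` and no loop, so it can be exchanged.
      subst hxe
      have heBF : r (insert x (B ∪ F)) = r (B ∪ F) := by
        refine le_antisymm ?_ (hr.mono (subset_insert _ _))
        rw [hB.2.2]
        exact hr.mono (insert_subset heG (union_subset (hB.1.trans sdiff_subset) hFG))
      obtain ⟨f, hfB, hf⟩ := hr.exists_exchange heB (by omega) le_rfl heBF
      refine ⟨f, lt_of_le_of_ne (hmax f (hB.1 hfB)) fun h => heB (h ▸ hfB), ?_, ?_, ?_⟩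
      · exact (erase_subset _ _).trans
          (insert_subset (mem_sdiff.2 ⟨heG, heF⟩) hB.1)
      · rw [card_erase_of_mem (mem_insert_of_mem hfB), card_insert_of_notMem heB,
          Nat.add_sub_cancel, hB.2.1]
      · rw [hf, heBF, hB.2.2]
    · have hx' : x ∈ (G.erase e \ F) \ B := by
        simp only [mem_sdiff, mem_erase] at hx ⊢
        exact ⟨⟨⟨hxe, hx.1.1⟩, hx.1.2⟩, hx.2⟩
      obtain ⟨f, hf, hfB⟩ := hex x hx'
      exact ⟨f, hf, (haux x hx' f).1 hfB⟩

lemma internalActive_erase (hmax : ∀ x ∈ G \ F, x ≤ e) (h' : r (G.erase e) = r G)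
    {B : Finset α} (hB : B ⊆ G \ F) (heB : e ∉ B) :
    internalActive r F G B = internalActive r F (G.erase e) B := by
  classical
  refine filter_congr fun x hx => forall₂_congr fun f hf => ?_
  have hfe : e ≠ f := by
    rintro rfl
    exact absurd (hmax x (hB hx)) (not_le.2 hf)
  rw [isMinorBase_erase_iff _ h']
  simp [hfe, heB]

lemma card_internalActive_insert (heF : e ∉ F) (heG : e ∈ G)
    (hmax : ∀ x ∈ G \ F, x ≤ e) (h : r (insert e F) = r F + 1) {B : Finset α} (heB : e ∉ B)
    (hB : B ⊆ G \ insert e F) [Decidable (∀ f < e, ¬ IsMinorBase r F G (insert f B))] :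
    #(internalActive r F G (insert e B)) = #(internalActive r (insert e F) G B) +
      if ∀ f < e, ¬ IsMinorBase r F G (insert f B) then 1 else 0 := by
  classical
  have key : B.filter (fun x => ∀ f < x, ¬ IsMinorBase r F G (insert f ((insert e B).erase x))) =
      internalActive r (insert e F) G B := by
    refine filter_congr fun x hx => forall₂_congr fun f hf => ?_
    have hxe : e ≠ x := fun h => heB (h ▸ hx)
    have hfe : e ≠ f := by
      rintro rfl
      refine absurd (hmax x ?_) (not_le.2 hf)
      have := mem_sdiff.1 (hB hx)
      exact mem_sdiff.2 ⟨this.1, fun h => this.2 (mem_insert_of_mem h)⟩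
    rw [erase_insert_of_ne hxe, insert_comm, isMinorBase_insert_iff heF heG _ h]
    simp [hfe, heB]
  rw [internalActive, filter_insert, erase_insert heB, key]
  split_ifs
  · rw [card_insert_of_notMem]
    exact fun h => heB (mem_filter.1 h).1
  · rw [add_zero]

end Recursion

/-- The generating function of the activities satisfies the same recursion as the corank-nullity
polynomial, by deletion and contraction of the largest element. -/
theorem activityPoly_eq_intervalPoly {r : Finset α → ℕ} (hr : IsRankFunction r)
    {F G : Finset α} (hFG : F ⊆ G) : activityPoly r F G = intervalPoly r F G := by
  classical
  induction hn : #(G \ F) generalizing F G with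
  | zero =>
    have : G = F := subset_antisymm (sdiff_eq_empty_iff_subset.1 (card_eq_zero.1 hn)) hFG
    rw [this, activityPoly_self, intervalPoly_self]
  | succ n ih =>
    have hne : (G \ F).Nonempty := card_pos.1 (by omega)
    obtain ⟨he, hmax⟩ : (G \ F).max' hne ∈ G \ F ∧ ∀ x ∈ G \ F, x ≤ (G \ F).max' hne :=
      ⟨max'_mem _ hne, fun x hx => le_max' _ x hx⟩
    generalize (G \ F).max' hne = e at he hmax
    obtain ⟨heG, heF⟩ := mem_sdiff.1 he
    have hc1 : #(G \ insert e F) = n := by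
      rw [sdiff_insert, card_erase_of_mem he, hn]; rfl
    have hc2 : #(G.erase e \ F) = n := by
      rw [erase_sdiff_comm, card_erase_of_mem he, hn]; rfl
    have ih1 := ih (insert_subset heG hFG) hc1
    have ih2 := ih (subset_erase.2 ⟨hFG, heF⟩) hc2
    by_cases hloop : r (insert e F) = r F
    · rw [activityPoly, noExternalBases_loop hr heF heG hloop, sum_empty,
        intervalPoly_eq_zero hr heF heG hloop]
    have hnl : r (insert e F) = r F + 1 := by
      have a1 : r F ≤ r (insert e F) := hr.mono (subset_insert e F)
      have a2 := hr.insert_le e F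
      omega
    have hsub : ∀ B ∈ noExternalBases r (insert e F) G, e ∉ B := fun B hB heB =>
      (mem_sdiff.1 ((mem_noExternalBases.1 hB).1.1 heB)).2 (mem_insert_self e F)
    -- The part of the sum over the bases containing `e`.
    have hcon : ∑ B ∈ (noExternalBases r F G).filter (fun B => e ∈ B),
        (X : ℤ[X]) ^ #(internalActive r F G B) =
        (if r (G.erase e) = r G then 1 else X) * activityPoly r (insert e F) G := by
      rw [activityPoly, mul_sum]
      refine sum_nbij' (fun B => B.erase e) (fun B => insert e B) ?_ ?_ ?_ ?_ ?_
      · intro B hB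
        obtain ⟨h1, h2⟩ := mem_filter.1 hB
        rw [← insert_mem_noExternalBases_iff heF heG hmax hnl (notMem_erase e B),
          insert_erase h2]
        exact h1
      · intro B hB
        exact mem_filter.2 ⟨(insert_mem_noExternalBases_iff heF heG hmax hnl (hsub B hB)).2 hB,
          mem_insert_self e B⟩
      · intro B hB
        exact insert_erase (mem_filter.1 hB).2
      · intro B hB
        exact erase_insert (hsub B hB)
      · intro B' hB'
        obtain ⟨h1, h2⟩ := mem_filter.1 hB'
        obtain ⟨B, heB, rfl⟩ : ∃ B, e ∉ B ∧ B' = insert e B :=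
          ⟨B'.erase e, notMem_erase e B', (insert_erase h2).symm⟩
        rw [insert_mem_noExternalBases_iff heF heG hmax hnl heB] at h1
        have hB := (mem_noExternalBases.1 h1).1
        rw [erase_insert heB, card_internalActive_insert heF heG hmax hnl heB hB.1]
        by_cases hco : r (G.erase e) = r G
        · -- Some element of `G` other than `e` extends `B ∪ F`.
          rw [if_pos hco, if_neg, add_zero, one_mul]
          intro hall
          have a1 := hr.union_le B F
          have a2 := hB.2.1
          have a3 : ∀ f ∈ G.erase e, r (insert f (B ∪ F)) = r (B ∪ F) := by
            intro f hf
            by_contra hne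
            obtain ⟨hfe, hfG⟩ := mem_erase.1 hf
            have a4 : r (B ∪ F) ≤ r (insert f (B ∪ F)) := hr.mono (subset_insert _ _)
            have a5 := hr.insert_le f (B ∪ F)
            have hfBF : f ∉ B ∪ F := fun h => hne (by rw [insert_eq_of_mem h])
            have hfB : f ∉ B := fun h => hfBF (mem_union_left _ h)
            have hfF : f ∉ F := fun h => hfBF (mem_union_right _ h)
            have a6 := hr.insert_le e (B ∪ F)
            rw [← union_insert, hB.2.2] at a6
            refine hall f (lt_of_le_of_ne (hmax f (mem_sdiff.2 ⟨hfG, hfF⟩)) hfe) ⟨?_, ?_, ?_⟩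
            · refine insert_subset (mem_sdiff.2 ⟨hfG, hfF⟩) (hB.1.trans ?_)
              exact sdiff_subset_sdiff le_rfl (subset_insert e F)
            · rw [card_insert_of_notMem hfB]; omega
            · rw [insert_union]; omega
          have a4 := hr.union_eq a3
          have a5 : r (G.erase e) ≤ r (G.erase e ∪ (B ∪ F)) := hr.mono subset_union_left
          omega
        · rw [if_neg hco, if_pos, pow_succ, mul_comm]
          intro f hf hbase
          rcases mem_insert.1 (hbase.mem_of_coloop hr heF hFG hco) with h | h
          · exact hf.ne h.symm
          · exact heB h
    have hsum := sum_filter_add_sum_filter_not (noExternalBases r F G) (fun B => e ∈ B)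
      (fun B => (X : ℤ[X]) ^ #(internalActive r F G B))
    rw [hcon] at hsum
    rw [activityPoly, ← hsum, ih1]
    by_cases hco : r (G.erase e) = r G
    · rw [if_pos hco, one_mul, intervalPoly_deletion_contraction heF hco hnl, ← ih2, add_comm,
        activityPoly]
      have hset : (noExternalBases r F G).filter (fun B => e ∉ B) =
          noExternalBases r F (G.erase e) := by
        ext B
        rw [mem_filter]
        constructor
        · rintro ⟨h1, h2⟩
          exact (mem_noExternalBases_erase_iff hr heF heG hFG hmax hnl hco h2).1 h1
        · intro h
          have h2 : e ∉ B := fun heB => notMem_erase e G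
            (mem_sdiff.1 ((mem_noExternalBases.1 h).1.1 heB)).1
          exact ⟨(mem_noExternalBases_erase_iff hr heF heG hFG hmax hnl hco h2).2 h, h2⟩
      rw [← hset]
      congr 1
      refine sum_congr rfl fun B hB => ?_
      obtain ⟨h1, h2⟩ := mem_filter.1 hB
      rw [internalActive_erase hmax hco (mem_noExternalBases.1 h1).1.1 h2]
    · rw [if_neg hco, intervalPoly_coloop hr heF heG hFG hco, add_eq_left]
      refine sum_eq_zero fun B hB => ?_
      obtain ⟨h1, h2⟩ := mem_filter.1 hB
      exact absurd ((mem_noExternalBases.1 h1).1.mem_of_coloop hr heF hFG hco) h2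

end Activity

/-! ### Tutte coefficients of minors of a matroid -/

section Matroid

open Finset

variable {α : Type*} [LinearOrder α]

/-- The rank function of a matroid on finite sets. -/
noncomputable def rankFn {α : Type*} (M : Matroid α) (A : Finset α) : ℕ := (M.eRk (A : Set α)).toNat

lemma coe_rankFn {α : Type*} [Finite α] (M : Matroid α) (A : Finset α) :
    (rankFn M A : ℕ∞) = M.eRk (A : Set α) := by
  refine ENat.natCast_toNat (ne_top_of_le_ne_top ?_ (M.eRk_le_encard _))
  exact Set.encard_ne_top_iff.2 (Set.toFinite _)

lemma isRankFunction_rankFn [Finite α] (M : Matroid α) (hE : M.E = Set.univ) :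
    IsRankFunction (rankFn M) where
  mono A B h := by
    rw [← Nat.cast_le (α := ℕ∞), coe_rankFn, coe_rankFn]
    exact M.eRk_mono (coe_subset.2 h)
  insert_le e A := by
    rw [← Nat.cast_le (α := ℕ∞), Nat.cast_add, coe_rankFn, coe_rankFn, coe_insert]
    exact M.eRk_insert_le_add_one e A
  insert_eq := by
    intro e A C hAC h
    rw [← Nat.cast_inj (R := ℕ∞), coe_rankFn, coe_rankFn, coe_insert] at h ⊢
    have he : e ∈ M.closure A := by
      by_contra he
      have h1 := M.eRk_insert_eq_add_one (X := (A : Set α)) (e := e) ⟨by simp [hE], he⟩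
      rw [h, ← coe_rankFn] at h1
      norm_cast at h1
      omega
    rw [← M.eRk_closure_eq (insert e C), Matroid.closure_insert_eq_of_mem_closure
      (M.closure_subset_closure (coe_subset.2 hAC) he), M.eRk_closure_eq]

lemma isBase_minor_iff [Finite α] (M : Matroid α) (hE : M.E = Set.univ) {F G : Finset α}
    (hFG : F ⊆ G) (B : Finset α) :
    ((M ↾ (G : Set α)) ／ (F : Set α)).IsBase B ↔ IsMinorBase (rankFn M) F G B := by
  have hFG' : (F : Set α) ⊆ G := coe_subset.2 hFG
  obtain ⟨I, hI⟩ := (M ↾ (G : Set α)).exists_isBasis (F : Set α) (by simpa using hFG')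
  have hIF : I ⊆ F := hI.subset
  have hIfin : I.Finite := Set.toFinite I
  have hIc : (I.ncard : ℕ∞) = rankFn M F := by
    rw [coe_rankFn, hIfin.cast_ncard_eq, hI.encard_eq_eRk, M.restrict_eRk_eq hFG']
  have hIc' : I.ncard = rankFn M F := by exact_mod_cast hIc
  have hrk : ∀ B : Finset α, M.eRk (B ∪ I : Set α) = rankFn M (B ∪ F) := by
    intro B
    have hI' : M.IsBasis' I F := by
      have := (Matroid.isBasis_restrict_iff'.1 hI).1
      rw [Set.inter_eq_self_of_subset_left (by rw [hE]; exact Set.subset_univ _)] at this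
      exact this.isBasis'
    rw [coe_rankFn, coe_union, Set.union_comm, Set.union_comm (B : Set α),
      hI'.eRk_eq_eRk_union]
  have hspan : ((M ↾ (G : Set α)) ／ (F : Set α)).IsBase B ↔
      ((M ↾ (G : Set α)) ／ (F : Set α)).Indep B ∧
        ((M ↾ (G : Set α)) ／ (F : Set α)).Spanning B :=
    ⟨fun h => ⟨h.indep, h.spanning⟩, fun h => h.1.isBase_of_spanning h.2⟩
  rw [hspan, hI.contract_indep_iff, Matroid.contract_spanning_iff (by simpa using hFG'),
    Matroid.restrict_indep_iff, Matroid.spanning_iff_eRk_le', Matroid.eRank_restrict]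
  constructor
  · rintro ⟨⟨⟨h1, h2⟩, h3⟩, ⟨h4, h5⟩, -⟩
    rw [Matroid.restrict_ground_eq] at h5
    have hBG : (B : Set α) ⊆ G := Set.subset_union_left.trans h2
    have hdisj : Disjoint (B : Set α) I := h3.symm.mono_right hIF
    rw [M.restrict_eRk_eq h5, ← coe_union, ← coe_rankFn, ← coe_rankFn, Nat.cast_le] at h4
    have h6 : rankFn M (B ∪ F) = rankFn M G := by
      refine le_antisymm ((isRankFunction_rankFn M hE).mono ?_) h4
      rw [← coe_subset, coe_union]; exact h5
    refine ⟨?_, ?_, h6⟩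
    · rw [← coe_subset, coe_sdiff]
      exact Set.subset_sdiff.2 ⟨hBG, h3.symm⟩
    · have h7 := h1.eRk_eq_encard
      rw [hrk, Set.encard_union_eq hdisj, Set.encard_coe_eq_coe_finsetCard,
        ← hIfin.cast_ncard_eq, hIc'] at h7
      rw [← h6]
      exact_mod_cast h7.symm
  · rintro ⟨h1, h2, h3⟩
    rw [← coe_subset, coe_sdiff, Set.subset_sdiff] at h1
    have hsub : (B ∪ F : Set α) ⊆ G := Set.union_subset h1.1 hFG'
    refine ⟨⟨⟨?_, (Set.union_subset_union_right _ hIF).trans hsub⟩, h1.2.symm⟩,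
      ⟨?_, by simpa using hsub⟩, h1.2⟩
    · refine Matroid.IsRkFinite.indep_of_encard_le_eRk ?_ ?_
      · exact M.isRkFinite_of_finite (Set.toFinite _)
      · rw [hrk, Set.encard_union_eq (h1.2.mono_right hIF), Set.encard_coe_eq_coe_finsetCard,
          ← hIfin.cast_ncard_eq, hIc', h3, ← h2]
        exact le_rfl
    · rw [M.restrict_eRk_eq hsub, ← coe_union, ← coe_rankFn, ← coe_rankFn, h3]

section Activities

variable {N : Matroid α} {r : Finset α → ℕ} {F G : Finset α}

lemma internalActivity_eq (hN : ∀ B : Finset α, N.IsBase B ↔ IsMinorBase r F G B)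
    {B : Finset α} (hB : N.IsBase B) :
    internalActivity N B = #(internalActive r F G B) := by
  classical
  rw [internalActivity, ← Set.ncard_coe_finset]
  congr 1
  ext e
  simp only [internalActive, Set.mem_ofPred_eq, coe_filter]
  refine and_congr_right fun he => ?_
  simp only [IsLeast, fundCocircuit, lowerBounds, Set.mem_ofPred_eq, ← hN]
  have h1 : ∀ f, (↑(insert f (B.erase e)) : Set α) = insert f ((B : Set α) \ {e}) := by
    intro f; simp
  constructor
  · rintro ⟨-, h⟩ f hf hb
    rw [h1] at hb
    exact absurd (h ⟨hb.subset_ground (Set.mem_insert _ _), hb⟩) (not_le.2 hf)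
  · intro h
    refine ⟨⟨hB.subset_ground he, ?_⟩, fun f hf => not_lt.1 fun hlt => h f hlt ?_⟩
    · rw [Set.insert_sdiff_singleton, Set.insert_eq_of_mem he]; exact hB
    · rw [h1]; exact hf.2

lemma externalActivity_eq_zero_iff [Finite α]
    (hN : ∀ B : Finset α, N.IsBase B ↔ IsMinorBase r F G B)
    (hNE : N.E = ((G \ F : Finset α) : Set α)) {B : Finset α}
    (hB : N.IsBase B) : externalActivity N B = 0 ↔ NoExternal r F G B := by
  rw [externalActivity, Set.ncard_eq_zero (Set.toFinite _), Set.eq_empty_iff_forall_notMem]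
  have h1 : ∀ e f, (↑((insert e B).erase f) : Set α) = insert e (B : Set α) \ {f} := by
    intro e f; simp
  have hmem : ∀ e, e ∈ N.E \ (B : Set α) ↔ e ∈ (G \ F) \ B := by
    intro e; rw [hNE, ← coe_sdiff, mem_coe]
  refine forall_congr' fun e => ?_
  rw [Set.mem_ofPred_eq, not_and, hmem]
  refine forall_congr' fun he => ?_
  simp only [IsLeast, fundCircuit, lowerBounds, Set.mem_ofPred_eq, ← hN, h1]
  have he' := (hmem e).2 he
  have hself : insert e (B : Set α) \ {e} = B := by
    rw [Set.insert_sdiff_of_mem _ (Set.mem_singleton e), Set.sdiff_singleton_eq_self he'.2]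
  constructor
  · intro h
    by_contra hcon
    push Not at hcon
    have hb : N.IsBase (insert e (B : Set α) \ {e}) := by rw [hself]; exact hB
    refine h ⟨⟨he'.1, hb⟩, fun f hf => not_lt.1 fun hlt => hcon f hlt hf.2⟩
  · rintro ⟨f, hfe, hf⟩ ⟨-, h⟩
    refine absurd (h ⟨?_, hf⟩) (not_le.2 hfe)
    -- Otherwise the basis `B` would be a proper subset of another one.
    by_contra hfE
    have hfB : f ∉ insert e (B : Set α) := fun h => hfE (by
      rcases h with rfl | h
      · exact he'.1
      · exact hB.subset_ground h)
    rw [Set.sdiff_singleton_eq_self hfB] at hf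
    have := hB.eq_of_subset_isBase hf (Set.subset_insert _ _)
    exact he'.2 (this ▸ Set.mem_insert _ _)

lemma tutteCoeff_eq_coeff_activityPoly [Finite α]
    (hN : ∀ B : Finset α, N.IsBase B ↔ IsMinorBase r F G B)
    (hNE : N.E = ((G \ F : Finset α) : Set α)) (i : ℕ) :
    tutteCoeff N i 0 = (activityPoly r F G).coeff i := by
  classical
  have := Fintype.ofFinite α
  have himage : {B : Set α | N.IsBase B} =
      (fun B : Finset α => (B : Set α)) ''
        ((univ.filter fun B : Finset α => N.IsBase B : Finset (Finset α)) : Set (Finset α)) := by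
    ext B
    simp only [Set.mem_ofPred_eq, coe_filter, mem_univ, true_and, Set.mem_image]
    constructor
    · intro h
      exact ⟨B.toFinite.toFinset, by simpa using h, by simp⟩
    · rintro ⟨B, h, rfl⟩; exact h
  have hsum : tuttePolynomial N = ∑ B ∈ univ.filter (fun B : Finset α => N.IsBase B),
      MvPolynomial.X 0 ^ internalActivity N B * MvPolynomial.X 1 ^ externalActivity N B := by
    have h1 := finsum_mem_image (s := ((univ.filter fun B : Finset α => N.IsBase B :
        Finset (Finset α)) : Set (Finset α))) (g := fun B : Finset α => (B : Set α))
        (f := fun B => (MvPolynomial.X 0 ^ internalActivity N B *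
          MvPolynomial.X 1 ^ externalActivity N B : MvPolynomial (Fin 2) ℤ))
        (coe_injective.injOn)
    rw [← himage, finsum_mem_coe_finset] at h1
    exact h1
  have hcoeff : ∀ a b : ℕ, (MvPolynomial.X 0 ^ a * MvPolynomial.X 1 ^ b :
      MvPolynomial (Fin 2) ℤ).coeff (Finsupp.single 0 i + Finsupp.single 1 0) =
      if b = 0 then (if i = a then 1 else 0) else 0 := by
    intro a b
    rw [MvPolynomial.X_pow_eq_monomial, MvPolynomial.X_pow_eq_monomial,
      MvPolynomial.monomial_mul, MvPolynomial.coeff_monomial, ← ite_and]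
    have : (Finsupp.single (0 : Fin 2) a + Finsupp.single 1 b =
        Finsupp.single 0 i + Finsupp.single 1 0) ↔ (b = 0 ∧ i = a) := by
      constructor
      · intro h
        have h0 := DFunLike.congr_fun h 0
        have h1 := DFunLike.congr_fun h 1
        simp at h0 h1
        exact ⟨h1, h0.symm⟩
      · rintro ⟨rfl, rfl⟩; rfl
    simp only [this, mul_one]
  rw [tutteCoeff, hsum, MvPolynomial.coeff_sum, activityPoly, Polynomial.finsetSum_coeff]
  simp only [hcoeff, Polynomial.coeff_X_pow]
  have hset : noExternalBases r F G =
      Finset.filter (fun B : Finset α => externalActivity N B = 0)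
        (univ.filter (fun B : Finset α => N.IsBase B)) := by
    ext B
    rw [mem_noExternalBases, mem_filter, mem_filter, ← hN]
    simp only [mem_univ, true_and]
    exact and_congr_right fun hB => (externalActivity_eq_zero_iff hN hNE hB).symm
  rw [hset, sum_filter (p := fun B : Finset α => externalActivity N B = 0)]
  refine sum_congr rfl fun B hB => ?_
  rw [internalActivity_eq hN (mem_filter.1 hB).2]

end Activities

theorem tutteCoeff_minor [Finite α] (M : Matroid α) (hE : M.E = Set.univ) {F G : Finset α}
    (hFG : F ⊆ G) (i : ℕ) :
    tutteCoeff ((M ↾ (G : Set α)) ／ (F : Set α)) i 0 =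
      (intervalPoly (rankFn M) F G).coeff i := by
  rw [tutteCoeff_eq_coeff_activityPoly (isBase_minor_iff M hE hFG) (by simp),
    activityPoly_eq_intervalPoly (isRankFunction_rankFn M hE) hFG]

end Matroid

/-! ### Tutte coefficients as sums over flags of flats -/

section FlagSum

open Finset

variable {α : Type*} [LinearOrder α] [Fintype α]

open Classical in
/-- The factor `β(M|B/A)` of a step from `A` to the flat `B`, set to zero unless the step adds the
element `e A` chosen outside `A`. -/
noncomputable def stepWeight (M : Matroid α) (e : Finset α → α) (A B : Finset α) : ℤ :=
  if A ⊆ B ∧ e A ∉ A ∧ e A ∈ B ∧ M.IsFlat B then (intervalPoly (rankFn M) A B).coeff 1 else 0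

lemma sum_fin_cons {T R : Type*} [Fintype T] [AddCommMonoid R] {m : ℕ}
    (f : (Fin (m + 1) → T) → R) :
    ∑ c, f c = ∑ a : T, ∑ c : Fin m → T, f (Fin.cons a c) := by
  rw [← (Fin.consEquiv fun _ : Fin (m + 1) => T).sum_comp, Fintype.sum_prod_type]
  rfl

/-- If `B` is not a flat, then `M/B` has a loop, so only flats contribute. -/
lemma intervalPoly_eq_zero_of_not_isFlat (M : Matroid α) (hE : M.E = Set.univ) {B : Finset α}
    (hB : ¬ M.IsFlat B) : intervalPoly (rankFn M) B univ = 0 := by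
  have hsub : (B : Set α) ⊆ M.closure B := M.subset_closure _ (by simp [hE])
  have hne : ¬ M.closure B ⊆ B := fun h =>
    hB (Matroid.isFlat_iff_closure_eq.2 (subset_antisymm h hsub))
  obtain ⟨f, hf, hfB⟩ := Set.not_subset.1 hne
  refine intervalPoly_eq_zero (isRankFunction_rankFn M hE) (e := f) (by simpa using hfB)
    (mem_univ f) ?_
  rw [← Nat.cast_inj (R := ℕ∞), coe_rankFn, coe_rankFn, coe_insert, ← M.eRk_closure_eq,
    Matroid.closure_insert_eq_of_mem_closure hf, M.eRk_closure_eq]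

lemma coeff_intervalPoly_succ (M : Matroid α) (hE : M.E = Set.univ) {e : Finset α → α}
    (he : ∀ A ≠ univ, e A ∉ A) (A : Finset α) (m : ℕ) :
    (intervalPoly (rankFn M) A univ).coeff (m + 1) =
      ∑ B, stepWeight M e A B * (intervalPoly (rankFn M) B univ).coeff m := by
  by_cases hA : A = univ
  · subst hA
    rw [intervalPoly_self, Polynomial.coeff_one, if_neg (Nat.succ_ne_zero m)]
    refine (sum_eq_zero fun B _ => ?_).symm
    simp [stepWeight]
  · have heA := he A hA
    rw [intervalPoly_eq_sum (isRankFunction_rankFn M hE) heA (mem_univ _),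
      Polynomial.coeff_X_mul, Polynomial.finsetSum_coeff]
    simp only [Polynomial.coeff_C_mul]
    refine sum_subset_zero_on_sdiff (subset_univ _) ?_ ?_
    · intro B hB
      have : ¬ (A ⊆ B ∧ e A ∉ A ∧ e A ∈ B ∧ M.IsFlat B) := fun h =>
        (mem_sdiff.1 hB).2 (mem_Icc.2 ⟨insert_subset h.2.2.1 h.1, subset_univ B⟩)
      rw [stepWeight, if_neg this, zero_mul]
    · intro B hB
      have hAB := insert_subset_iff.1 (mem_Icc.1 hB).1
      by_cases hflat : M.IsFlat B
      · rw [stepWeight, if_pos ⟨hAB.2, heA, hAB.1, hflat⟩]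
      · rw [intervalPoly_eq_zero_of_not_isFlat M hE hflat]; simp

open Classical in
lemma coeff_intervalPoly_eq_sum_chains (M : Matroid α) (hE : M.E = Set.univ)
    {e : Finset α → α} (he : ∀ A ≠ univ, e A ∉ A) (m : ℕ) (A : Finset α) :
    (intervalPoly (rankFn M) A univ).coeff m =
      ∑ c : Fin (m + 1) → Finset α, if c 0 = A ∧ c (Fin.last m) = univ then
        ∏ i : Fin m, stepWeight M e (c i.castSucc) (c i.succ) else 0 := by
  induction m generalizing A with
  | zero =>
    have hsum : (∑ c : Fin 1 → Finset α, if c 0 = A ∧ c (Fin.last 0) = univ then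
        ∏ i : Fin 0, stepWeight M e (c i.castSucc) (c i.succ) else 0) =
        if A = univ then 1 else 0 := by
      rw [← (Equiv.funUnique (Fin 1) (Finset α)).symm.sum_comp]
      simp only [univ_eq_empty, prod_empty, ite_and]
      simp
    refine Eq.trans ?_ hsum.symm
    split_ifs with hA
    · rw [hA, intervalPoly_self, Polynomial.coeff_one_zero]
    · rw [intervalPoly_eq_sum (isRankFunction_rankFn M hE) (he A hA) (mem_univ _),
        Polynomial.coeff_X_mul_zero]
  | succ m ih =>
    rw [coeff_intervalPoly_succ M hE he, sum_fin_cons]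
    simp only [ih, ← Fin.succ_last, Fin.cons_zero, Fin.cons_succ, Fin.prod_univ_succ,
      Fin.castSucc_zero, ite_and, Fin.castSucc_succ]
    symm
    rw [sum_eq_single A]
    · simp only [if_true, mul_sum, mul_ite, mul_zero]
      rw [sum_comm]
      refine sum_congr rfl fun c _ => ?_
      rw [sum_ite_eq]
      simp
    · intro B _ hBA
      simp [hBA]
    · simp

open Classical in
/-- Iterating the convolution formula: `t_{k+1,0}` is the sum of the products of the
beta invariants over the flags of flats in which each flat contains the element chosen outside the
preceding one. -/
theorem tutteCoeff_eq_sum_flags {k : ℕ} (M : Matroid α) [Fintype (ProperFlag M (k + 1))]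
    (hE : M.E = Set.univ) (hM : M.IsFlat ∅)
    {e : Set α → α} (he : ∀ A ≠ Set.univ, e A ∉ A) :
    ∑ F : ProperFlag M (k + 1),
      (if ∀ i : Fin (k + 1), e (F.flat i.castSucc) ∈ F.flat i.succ then
        ∏ i : Fin (k + 1), betaInvariant ((M ↾ F.flat i.succ) ／ F.flat i.castSucc) else 0) =
      tutteCoeff M (k + 1) 0 := by
  have hM' : tutteCoeff M (k + 1) 0 = (intervalPoly (rankFn M) ∅ univ).coeff (k + 1) := by
    rw [← tutteCoeff_minor M hE (empty_subset _), coe_empty, Matroid.contract_empty, coe_univ,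
      ← hE, Matroid.restrict_ground_eq_self]
  have he' : ∀ A ≠ (univ : Finset α), e A ∉ A := fun A hA h =>
    he A (by simpa using hA) (by simpa using h)
  rw [hM', coeff_intervalPoly_eq_sum_chains M hE (e := fun A => e A) he' (k + 1) ∅]
  refine sum_of_injOn (fun F i => (F.flat i).toFinset) ?_ (by simp) ?_ ?_
  · intro F _ F' _ h
    ext i x
    have := congrFun h i
    simpa using congrArg (x ∈ ·) this
  · intro c _ hc
    by_contra hne
    rw [ite_eq_right_iff, Classical.not_imp] at hne
    obtain ⟨⟨h0, h1⟩, h2⟩ := hne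
    have hstep : ∀ i : Fin (k + 1), c i.castSucc ⊆ c i.succ ∧ e (c i.castSucc) ∉ c i.castSucc ∧
        e (c i.castSucc) ∈ c i.succ ∧ M.IsFlat (c i.succ : Set α) := by
      intro i
      by_contra h
      exact h2 (prod_eq_zero (mem_univ i) (if_neg h))
    refine hc ⟨⟨fun i => c i, ?_, ?_, ?_, ?_⟩, by simp, by ext; simp⟩
    · intro i
      refine Fin.cases ?_ (fun i => (hstep i).2.2.2) i
      rw [h0, coe_empty]; exact hM
    · refine Fin.strictMono_iff_lt_succ.2 fun i => ?_
      refine _root_.ssubset_iff_subset_ne.2 ⟨coe_subset.2 (hstep i).1, fun h => (hstep i).2.1 ?_⟩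
      rw [coe_inj.1 h]
      convert (hstep i).2.2.1 using 2
      exact h.symm
    · simp [h0]
    · simp [h1, hE]
  · intro F _
    have hcond : (F.flat 0).toFinset = ∅ ∧ (F.flat (Fin.last (k + 1))).toFinset = univ := by
      simp [F.flat_zero, F.flat_last, hE]
    rw [if_pos hcond]
    have hss : ∀ i : Fin (k + 1), F.flat i.castSucc ⊂ F.flat i.succ := fun i =>
      F.strictMono (Fin.castSucc_lt_succ (i := i))
    have hbeta : ∀ i : Fin (k + 1), betaInvariant ((M ↾ F.flat i.succ) ／ F.flat i.castSucc) =
        (intervalPoly (rankFn M) (F.flat i.castSucc).toFinset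
          (F.flat i.succ).toFinset).coeff 1 := by
      intro i
      rw [← tutteCoeff_minor M hE (by simpa using (hss i).subset)]
      simp [betaInvariant]
    have hout : ∀ i : Fin (k + 1), e (F.flat i.castSucc) ∉ F.flat i.castSucc := fun i => by
      refine he _ fun h => ?_
      have := (hss i).2
      rw [h] at this
      exact this (Set.subset_univ _)
    split_ifs with h
    · refine prod_congr rfl fun i _ => ?_
      rw [hbeta, stepWeight, if_pos]
      simpa [hout i, h i, F.isFlat] using (hss i).subset
    · push Not at h
      obtain ⟨i, hi⟩ := h
      refine (prod_eq_zero (mem_univ i) (if_neg ?_)).symm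
      simp [hi]

end FlagSum

/-! ### Cones of flags in terms of level sets -/

section Cones

open Finset

variable {α : Type*}

/-- The quotient map `ℝ^α → ℝ^α / ℝ·(1, …, 1)`. -/
noncomputable abbrev toAmbient (α : Type*) : (α → ℝ) →ₗ[ℝ] Ambient α :=
  Submodule.mkQ (Submodule.span ℝ {(1 : α → ℝ)})

lemma toAmbient_eq_iff {x y : α → ℝ} :
    toAmbient α x = toAmbient α y ↔ ∃ c : ℝ, ∀ a, x a = y a + c := by
  rw [← sub_eq_zero, ← map_sub, Submodule.mkQ_apply, Submodule.Quotient.mk_eq_zero,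
    Submodule.mem_span_singleton]
  refine exists_congr fun c => ?_
  rw [funext_iff]
  refine forall_congr' fun a => ?_
  simp only [Pi.smul_apply, Pi.one_apply, Pi.sub_apply, smul_eq_mul, mul_one]
  constructor <;> intro h <;> linarith

lemma sum_range_ite_sub (c : ℕ → ℝ) {m j : ℕ} (h : m ≤ j) :
    ∑ i ∈ range j, (if m ≤ i then c i - c (i + 1) else 0) = c m - c j := by
  induction j, h using Nat.le_induction with
  | base =>
    rw [sub_self]
    refine sum_eq_zero fun i hi => if_neg ?_
    simpa using hi
  | succ j h ih => rw [sum_range_succ, ih, if_pos h]; ring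

variable {M : Matroid α} {j : ℕ}

lemma ProperFlag.exists_block {ℓ : ℕ} (F : ProperFlag M ℓ) (hE : M.E = Set.univ) (a : α) :
    ∃ i : Fin ℓ, a ∈ F.flat i.succ ∧ a ∉ F.flat i.castSucc := by
  by_contra! h
  have : ∀ i : Fin (ℓ + 1), a ∈ F.flat i := by
    intro i
    induction i using Fin.reverseInduction with
    | last => rw [F.flat_last, hE]; trivial
    | cast i ih => exact h i ih
  have h0 := this 0
  rw [F.flat_zero] at h0
  exact h0

/-- The index `i` of the block `F_{i+1} \ F_i` of a flag that contains `a`. -/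
noncomputable def ProperFlag.block {ℓ : ℕ} (F : ProperFlag M ℓ) (hE : M.E = Set.univ) (a : α) :
    Fin ℓ :=
  (F.exists_block hE a).choose

lemma ProperFlag.mem_flat_iff {ℓ : ℕ} (F : ProperFlag M ℓ) (hE : M.E = Set.univ) {a : α}
    {i : Fin (ℓ + 1)} : a ∈ F.flat i ↔ (F.block hE a).castSucc < i := by
  obtain ⟨h1, h2⟩ := (F.exists_block hE a).choose_spec
  change a ∈ F.flat (F.block hE a).succ at h1
  change a ∉ F.flat (F.block hE a).castSucc at h2
  constructor
  · intro h
    by_contra hlt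
    exact h2 (F.strictMono.monotone (not_lt.1 hlt) h)
  · intro h
    exact F.strictMono.monotone (Fin.castSucc_lt_iff_succ_le.1 h) h1

lemma ProperFlag.block_surjective {ℓ : ℕ} (F : ProperFlag M ℓ) (hE : M.E = Set.univ) :
    Function.Surjective (F.block hE) := by
  intro i
  obtain ⟨a, h1, h2⟩ := Set.exists_of_ssubset (F.strictMono (Fin.castSucc_lt_succ (i := i)))
  refine ⟨a, ?_⟩
  rw [F.mem_flat_iff hE] at h1 h2
  rw [Fin.lt_def] at h1 h2
  simp only [Fin.val_castSucc, Fin.val_succ] at h1 h2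
  exact Fin.ext (by omega)

lemma ProperFlag.block_le_iff {ℓ : ℕ} (F : ProperFlag M ℓ) (hE : M.E = Set.univ) {a b : α} :
    F.block hE a ≤ F.block hE b ↔ ∀ i, b ∈ F.flat i → a ∈ F.flat i := by
  simp only [F.mem_flat_iff hE]
  constructor
  · intro h i hi
    exact lt_of_le_of_lt (Fin.castSucc_le_castSucc_iff.2 h) hi
  · intro h
    have := h (F.block hE b).succ (Fin.castSucc_lt_succ)
    rw [Fin.lt_def] at this
    simp only [Fin.val_castSucc, Fin.val_succ] at this
    exact Fin.le_def.2 (by omega)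

/-- A function that depends on the block only, as a combination of the generators of the cone. -/
lemma toAmbient_eq_sum (F : ProperFlag M (j + 1)) (hE : M.E = Set.univ) {x : α → ℝ} (c : ℕ → ℝ)
    (hx : ∀ a, x a = c (F.block hE a)) :
    toAmbient α x =
      ∑ i : Fin j, (c i - c (i + 1)) • indicatorVec (F.flat i.castSucc.succ) := by
  have h1 : ∑ i : Fin j, (c i - c (i + 1)) • indicatorVec (F.flat i.castSucc.succ) =
      toAmbient α (∑ i : Fin j,
        (c i - c (i + 1)) • (F.flat i.castSucc.succ).indicator (1 : α → ℝ)) := by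
    rw [map_sum]; rfl
  rw [h1, toAmbient_eq_iff]
  refine ⟨c j, fun a => ?_⟩
  have hle : (F.block hE a : ℕ) ≤ j := Nat.lt_succ_iff.1 (F.block hE a).isLt
  rw [hx, Finset.sum_apply, ← sub_eq_iff_eq_add, ← sum_range_ite_sub c hle,
    ← Fin.sum_univ_eq_sum_range (fun i => if (F.block hE a : ℕ) ≤ i then c i - c (i + 1) else 0)]
  refine sum_congr rfl fun i _ => ?_
  have hiff : a ∈ F.flat i.castSucc.succ ↔ (F.block hE a : ℕ) ≤ i := by
    rw [F.mem_flat_iff hE, Fin.lt_def]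
    simp only [Fin.val_castSucc, Fin.val_succ]
    omega
  rw [Pi.smul_apply, smul_eq_mul]
  split_ifs with h
  · rw [Set.indicator_of_mem (hiff.2 h), Pi.one_apply, mul_one]
  · rw [Set.indicator_of_notMem (mt hiff.1 h), mul_zero]

lemma exists_eq_comp_block (F : ProperFlag M (j + 1)) (hE : M.E = Set.univ) {x : α → ℝ}
    (hx : ∀ a b, F.block hE a = F.block hE b → x a = x b) :
    ∃ c : ℕ → ℝ, ∀ a, x a = c (F.block hE a) := by
  choose s hs using F.block_surjective hE
  refine ⟨fun i => if h : i < j + 1 then x (s ⟨i, h⟩) else 0, fun a => ?_⟩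
  simp only [Fin.is_lt, dif_pos]
  exact hx _ _ (hs _).symm

lemma span_flagCone (F : ProperFlag M (j + 1)) :
    Submodule.span ℝ (flagCone F : Set (Ambient α)) =
      Submodule.span ℝ (Set.range fun i : Fin j => indicatorVec (F.flat i.castSucc.succ)) :=
  Submodule.span_span_of_tower _ _ _

lemma finrank_span_flagCone (F : ProperFlag M (j + 1)) :
    Module.finrank ℝ (Submodule.span ℝ (flagCone F : Set (Ambient α))) = j :=
  finrank_span_hull_range (flagVec_linearIndependent F)

lemma toAmbient_mem_span_flagCone (F : ProperFlag M (j + 1)) (hE : M.E = Set.univ) {x : α → ℝ}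
    (hx : ∀ a b, F.block hE a = F.block hE b → x a = x b) :
    toAmbient α x ∈ Submodule.span ℝ (flagCone F : Set (Ambient α)) := by
  obtain ⟨c, hc⟩ := exists_eq_comp_block F hE hx
  rw [span_flagCone, toAmbient_eq_sum F hE c hc]
  exact Submodule.sum_mem _ fun i _ =>
    Submodule.smul_mem _ _ (Submodule.subset_span ⟨i, rfl⟩)

/-- The difference of two coordinates in the same block vanishes on the span of the cone. -/
lemma eq_of_toAmbient_mem_span_flagCone (F : ProperFlag M (j + 1)) (hE : M.E = Set.univ)
    {x : α → ℝ} (hx : toAmbient α x ∈ Submodule.span ℝ (flagCone F : Set (Ambient α))) {a b : α}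
    (hab : F.block hE a = F.block hE b) : x a = x b := by
  rw [span_flagCone, Submodule.mem_span_range_iff_exists_fun] at hx
  obtain ⟨c, hc⟩ := hx
  have h1 : ∑ i : Fin j, c i • indicatorVec (F.flat i.castSucc.succ) =
      toAmbient α (∑ i : Fin j, c i • (F.flat i.castSucc.succ).indicator (1 : α → ℝ)) := by
    rw [map_sum]; rfl
  rw [h1] at hc
  obtain ⟨t, ht⟩ := toAmbient_eq_iff.1 hc.symm
  rw [ht, ht, Finset.sum_apply, Finset.sum_apply]
  congr 1
  refine sum_congr rfl fun i _ => ?_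
  have hiff : a ∈ F.flat i.castSucc.succ ↔ b ∈ F.flat i.castSucc.succ := by
    rw [F.mem_flat_iff hE, F.mem_flat_iff hE, hab]
  rw [Pi.smul_apply, Pi.smul_apply]
  by_cases h : a ∈ F.flat i.castSucc.succ
  · rw [Set.indicator_of_mem h, Set.indicator_of_mem (hiff.1 h)]; rfl
  · rw [Set.indicator_of_notMem h, Set.indicator_of_notMem (mt hiff.2 h)]

/-- The cone of a flag consists of the classes of the functions that decrease along its blocks. -/
lemma toAmbient_mem_flagCone_iff (F : ProperFlag M (j + 1)) (hE : M.E = Set.univ) {x : α → ℝ} :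
    toAmbient α x ∈ flagCone F ↔ ∀ a b, F.block hE a ≤ F.block hE b → x b ≤ x a := by
  constructor
  · intro hx a b hab
    unfold flagCone at hx
    obtain ⟨c, hc⟩ := (Submodule.mem_span_range_iff_exists_fun _).1 hx
    have h1 : ∑ i : Fin j, c i • indicatorVec (F.flat i.castSucc.succ) =
        toAmbient α
          (∑ i : Fin j, (c i : ℝ) • (F.flat i.castSucc.succ).indicator (1 : α → ℝ)) := by
      rw [map_sum]; rfl
    rw [h1] at hc
    obtain ⟨t, ht⟩ := toAmbient_eq_iff.1 hc.symm
    rw [ht, ht, Finset.sum_apply, Finset.sum_apply]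
    gcongr with i _
    simp only [Pi.smul_apply, smul_eq_mul]
    refine mul_le_mul_of_nonneg_left ?_ (c i).2
    by_cases hb : b ∈ F.flat i.castSucc.succ
    · rw [Set.indicator_of_mem hb,
        Set.indicator_of_mem ((F.block_le_iff hE).1 hab _ hb)]
      simp
    · rw [Set.indicator_of_notMem hb]
      exact Set.indicator_nonneg (fun _ _ => zero_le_one) a
  · intro hx
    obtain ⟨c, hc⟩ := exists_eq_comp_block F hE
      fun a b h => le_antisymm (hx _ _ h.symm.le) (hx _ _ h.le)
    rw [toAmbient_eq_sum F hE c hc]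
    refine Submodule.sum_mem _ fun i _ => ?_
    have hnn : 0 ≤ c i - c (i + 1) := by
      obtain ⟨a, ha⟩ := F.block_surjective hE i.castSucc
      obtain ⟨b, hb⟩ := F.block_surjective hE i.succ
      have := hx a b (by rw [ha, hb]; exact Fin.castSucc_lt_succ.le)
      rw [hc, hc, ha, hb] at this
      simpa using this
    exact Submodule.smul_mem _ (⟨_, hnn⟩ : {c : ℝ // 0 ≤ c}) (Submodule.subset_span ⟨i, rfl⟩)

lemma ncard_range_le_of_mem_flagCone (F : ProperFlag M (j + 1)) (hE : M.E = Set.univ) {x : α → ℝ}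
    (hx : toAmbient α x ∈ flagCone F) : (Set.range x).ncard ≤ j + 1 := by
  obtain ⟨c, hc⟩ := exists_eq_comp_block F hE fun a b h =>
    eq_of_toAmbient_mem_span_flagCone F hE (Submodule.subset_span hx) h
  have hsub : Set.range x ⊆ c '' (Set.Iio (j + 1)) := by
    rintro _ ⟨a, rfl⟩
    exact ⟨_, (F.block hE a).isLt, (hc a).symm⟩
  calc (Set.range x).ncard ≤ (c '' Set.Iio (j + 1)).ncard :=
        Set.ncard_le_ncard hsub (Set.toFinite _)
    _ ≤ (Set.Iio (j + 1)).ncard := Set.ncard_image_le (Set.toFinite _)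
    _ = j + 1 := by rw [Set.ncard_eq_toFinset_card']; simp

/-- In the relative interior of the cone, the function separates the blocks. -/
lemma block_le_iff_of_ncard_range (F : ProperFlag M (j + 1)) (hE : M.E = Set.univ) {x : α → ℝ}
    (hx : toAmbient α x ∈ flagCone F) (hcard : (Set.range x).ncard = j + 1) {a b : α} :
    F.block hE a ≤ F.block hE b ↔ x b ≤ x a := by
  refine ⟨(toAmbient_mem_flagCone_iff F hE).1 hx a b, fun h => ?_⟩
  by_contra hlt
  have heq : x a = x b :=
    le_antisymm ((toAmbient_mem_flagCone_iff F hE).1 hx b a (not_le.1 hlt).le) h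
  obtain ⟨c, hc⟩ := exists_eq_comp_block F hE fun a b h =>
    eq_of_toAmbient_mem_span_flagCone F hE (Submodule.subset_span hx) h
  -- Otherwise the block of `a` could be left out without losing a value.
  have hsub : Set.range x ⊆ c '' (Set.Iio (j + 1) \ {(F.block hE a : ℕ)}) := by
    rintro _ ⟨d, rfl⟩
    by_cases hd : F.block hE d = F.block hE a
    · refine ⟨F.block hE b, ⟨(F.block hE b).isLt, fun h => hlt (Fin.ext h).ge⟩, ?_⟩
      rw [hc d, hd, ← hc a, ← hc b, heq]
    · exact ⟨F.block hE d, ⟨(F.block hE d).isLt, fun h => hd (Fin.ext h)⟩, (hc d).symm⟩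
  have h1 : (Set.range x).ncard ≤ j := calc
    (Set.range x).ncard ≤ (c '' (Set.Iio (j + 1) \ {(F.block hE a : ℕ)})).ncard :=
        Set.ncard_le_ncard hsub (Set.toFinite _)
    _ ≤ (Set.Iio (j + 1) \ {(F.block hE a : ℕ)}).ncard := Set.ncard_image_le (Set.toFinite _)
    _ = j := by
      rw [Set.ncard_sdiff_singleton_of_mem (Set.mem_Iio.2 (F.block hE a).isLt),
        Set.ncard_eq_toFinset_card']
      simp
  omega

lemma isFlat_superlevel_of_mem_flagCone [Finite α] (F : ProperFlag M (j + 1)) (hE : M.E = Set.univ)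
    {x : α → ℝ} (hx : toAmbient α x ∈ flagCone F) (t : ℝ) : M.IsFlat {a | t ≤ x a} := by
  rcases Set.eq_empty_or_nonempty {a | t ≤ x a} with h | h
  · rw [h, ← F.flat_zero]; exact F.isFlat 0
  · obtain ⟨a, ha, hmax⟩ := Set.exists_max_image _ (F.block hE) (Set.toFinite _) h
    have : {a | t ≤ x a} = F.flat (F.block hE a).succ := by
      ext b
      rw [F.mem_flat_iff hE, Fin.castSucc_lt_succ_iff]
      exact ⟨hmax b, fun hb => le_trans ha ((toAmbient_mem_flagCone_iff F hE).1 hx b a hb)⟩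
    rw [this]; exact F.isFlat _

/-- A function whose superlevel sets are flats lies in the cone of the flag formed by them. -/
lemma exists_flag_of_isFlat_superlevel [Finite α] [Nonempty α] (hE : M.E = Set.univ)
    (hM : M.IsFlat ∅) {x : α → ℝ} (hx : ∀ t, M.IsFlat {a | t ≤ x a}) :
    ∃ (j : ℕ) (F : ProperFlag M (j + 1)),
      (Set.range x).ncard = j + 1 ∧ toAmbient α x ∈ flagCone F := by
  classical
  have := Fintype.ofFinite α
  obtain ⟨j, hj⟩ : ∃ j, #(univ.image x) = j + 1 :=
    Nat.exists_eq_succ_of_ne_zero (card_pos.2 (univ_nonempty.image x)).ne'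
  let t : Fin (j + 1) ↪o ℝ := (univ.image x).orderEmbOfFin hj
  have hidx : ∀ a, ∃ i, t i = x a := by
    intro a
    have : x a ∈ Set.range t := by rw [range_orderEmbOfFin]; simp
    exact this
  choose idx hidx using hidx
  have hidx_surj : ∀ i, ∃ a, idx a = i := by
    intro i
    have : t i ∈ univ.image x := orderEmbOfFin_mem _ hj i
    obtain ⟨a, -, ha⟩ := mem_image.1 this
    exact ⟨a, t.injective (by rw [hidx, ha])⟩
  let flat : Fin (j + 2) → Set α := fun i => {a | j + 1 ≤ (i : ℕ) + idx a}
  let F : ProperFlag M (j + 1) :=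
    { flat := flat
      isFlat := by
        intro i
        by_cases hi : (i : ℕ) = 0
        · have : flat i = ∅ := by
            ext a
            have := (idx a).isLt
            simp only [flat, Set.mem_ofPred_eq, Set.mem_empty_iff_false, iff_false]
            omega
          rw [this]; exact hM
        · have hi' : j + 1 - (i : ℕ) < j + 1 := by omega
          have : flat i = {a | t ⟨j + 1 - i, hi'⟩ ≤ x a} := by
            ext a
            simp only [flat, Set.mem_ofPred_eq, ← hidx, t.le_iff_le, Fin.le_def]
            omega
          rw [this]; exact hx _
      strictMono := by
        intro i i' hii
        rw [Fin.lt_def] at hii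
        have hi' := i'.isLt
        refine Set.ssubset_iff_subset_ne.2 ⟨fun a ha => ?_, fun h => ?_⟩
        · simp only [flat, Set.mem_ofPred_eq] at ha ⊢
          omega
        · obtain ⟨a, ha⟩ := hidx_surj ⟨j + 1 - i', by omega⟩
          have h1 : a ∈ flat i' := by
            simp only [flat, Set.mem_ofPred_eq, ha]; omega
          rw [← h] at h1
          simp only [flat, Set.mem_ofPred_eq, ha] at h1
          omega
      flat_zero := by
        ext a
        have := (idx a).isLt
        simp only [flat, Set.mem_ofPred_eq, Set.mem_empty_iff_false, iff_false, Fin.val_zero]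
        omega
      flat_last := by
        rw [hE]
        ext a
        simp only [flat, Set.mem_ofPred_eq, Set.mem_univ, iff_true]
        simp }
  refine ⟨j, F, ?_, (toAmbient_mem_flagCone_iff F hE).2 fun a b hab => ?_⟩
  · rw [← hj, ← Set.ncard_coe_finset]; simp
  · rw [← hidx, ← hidx, t.le_iff_le, Fin.le_def]
    have hb := (idx b).isLt
    have h1 := (F.block_le_iff hE).1 hab ⟨j + 1 - idx b, by omega⟩
      (show j + 1 ≤ j + 1 - (idx b : ℕ) + idx b by omega)
    have h2 : j + 1 ≤ j + 1 - (idx b : ℕ) + idx a := h1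
    omega

end Cones

/-! ### Uniform matroids -/

section Uniform

variable {α : Type*} [Finite α] {r : ℕ}

lemma uniformMatroid_ground : (uniformMatroid α r).E = Set.univ := rfl

lemma uniformMatroid_indep_iff {I : Set α} : (uniformMatroid α r).Indep I ↔ I.ncard ≤ r :=
  Iff.rfl

lemma uniformMatroid_isFlat_of_ncard_lt {A : Set α} (hA : A.ncard < r) :
    (uniformMatroid α r).IsFlat A := by
  have hind : (uniformMatroid α r).Indep A := uniformMatroid_indep_iff.2 hA.le
  refine Matroid.isFlat_iff_closure_eq.2
    (subset_antisymm (fun e he => ?_) ((uniformMatroid α r).subset_closure A (Set.subset_univ _)))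
  by_contra heA
  refine ((hind.mem_closure_iff_of_notMem heA).1 he).not_indep (uniformMatroid_indep_iff.2 ?_)
  rw [Set.ncard_insert_of_notMem heA]
  exact hA

lemma uniformMatroid_ncard_lt_of_isFlat {A : Set α} (hA : (uniformMatroid α r).IsFlat A)
    (hne : A ≠ Set.univ) : A.ncard < r := by
  by_contra! hle
  obtain ⟨I, hIA, hI⟩ := Set.exists_subset_card_eq hle
  have hind : (uniformMatroid α r).Indep I := uniformMatroid_indep_iff.2 hI.le
  obtain ⟨e, he⟩ := (Set.ne_univ_iff_exists_notMem A).1 hne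
  have heI : e ∉ I := fun h => he (hIA h)
  refine he (hA.closure ▸ (uniformMatroid α r).closure_subset_closure hIA
    ((hind.mem_closure_iff_of_notMem heI).2 ?_))
  rw [Matroid.dep_iff, uniformMatroid_indep_iff, Set.ncard_insert_of_notMem heI, hI]
  exact ⟨by omega, Set.subset_univ _⟩

lemma uniformMatroid_eRank (h : r ≤ Nat.card α) : (uniformMatroid α r).eRank = r := by
  rw [← Set.ncard_univ] at h
  obtain ⟨I, -, hI⟩ := Set.exists_subset_card_eq h
  refine le_antisymm ?_ ?_
  · rw [← Matroid.eRk_ground, Matroid.eRk_le_iff]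
    intro J _ hJ
    rw [← (Set.toFinite J).cast_ncard_eq]
    exact_mod_cast uniformMatroid_indep_iff.1 hJ
  · have := (uniformMatroid_indep_iff.2 hI.le).encard_le_eRank
    rwa [← (Set.toFinite I).cast_ncard_eq, hI] at this

/-- In a flag of maximal length of a uniform matroid, the sizes of the flats increase by one. -/
lemma ncard_flat_uniformMatroid {l : ℕ} (G : ProperFlag (uniformMatroid α (l + 1)) (l + 1))
    (i : Fin (l + 1)) : (G.flat i.castSucc).ncard = i := by
  have hlt : ∀ i : Fin (l + 1), (G.flat i.castSucc).ncard < (G.flat i.succ).ncard := fun i =>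
    Set.ncard_lt_ncard (G.strictMono Fin.castSucc_lt_succ) (Set.toFinite _)
  have hup : ∀ i : Fin (l + 1), (G.flat i.castSucc).ncard ≤ i := by
    intro i
    induction i using Fin.reverseInduction with
    | last =>
      refine Nat.lt_succ_iff.1 (uniformMatroid_ncard_lt_of_isFlat (G.isFlat _) fun h => ?_)
      have h1 := G.strictMono (Fin.castSucc_lt_succ (i := Fin.last l))
      rw [h] at h1
      exact h1.2 (Set.subset_univ _)
    | cast i ih =>
      have := hlt i.castSucc
      rw [Fin.succ_castSucc] at this
      simp only [Fin.val_castSucc, Fin.val_succ] at ih ⊢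
      omega
  have hlo : ∀ i : Fin (l + 1), i ≤ (G.flat i.castSucc).ncard := by
    intro i
    induction i using Fin.induction with
    | zero => simp
    | succ i ih =>
      have := hlt i.castSucc
      rw [Fin.succ_castSucc] at this
      simp only [Fin.val_castSucc, Fin.val_succ] at ih ⊢
      omega
  exact le_antisymm (hup i) (hlo i)

/-- The blocks of a flag of maximal length of a uniform matroid are singletons, except the last. -/
lemma eq_of_block_eq_uniformMatroid {l : ℕ}
    (G : ProperFlag (uniformMatroid α (l + 1)) (l + 1)) {a b : α}
    (hab : G.block uniformMatroid_ground a = G.block uniformMatroid_ground b)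
    (hlast : G.block uniformMatroid_ground a ≠ Fin.last l) : a = b := by
  by_contra hne
  obtain ⟨i, hi⟩ := Fin.exists_castSucc_eq.2 hlast
  have h1 := ncard_flat_uniformMatroid G i.castSucc
  have h2 := ncard_flat_uniformMatroid G i.succ
  have hmem : ∀ c, c ∈ ({a, b} : Set α) → G.block uniformMatroid_ground c = i.castSucc := by
    rintro c (rfl | rfl)
    · exact hi.symm
    · exact hab.symm.trans hi.symm
  have hdisj : Disjoint (G.flat i.castSucc.castSucc) {a, b} := by
    refine Set.disjoint_left.2 fun c hc hc' => ?_
    rw [G.mem_flat_iff uniformMatroid_ground, hmem c hc'] at hc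
    exact lt_irrefl _ hc
  have hsub : G.flat i.castSucc.castSucc ∪ {a, b} ⊆ G.flat i.succ.castSucc := by
    refine Set.union_subset (G.strictMono.monotone ?_) fun c hc => ?_
    · exact Fin.castSucc_le_castSucc_iff.2 Fin.castSucc_lt_succ.le
    · rw [G.mem_flat_iff uniformMatroid_ground, hmem c hc]
      exact Fin.castSucc_lt_castSucc_iff.2 Fin.castSucc_lt_succ
  have h3 := Set.ncard_le_ncard hsub (Set.toFinite _)
  rw [Set.ncard_union_eq hdisj (Set.toFinite _) (Set.toFinite _), Set.ncard_pair hne, h1, h2] at h3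
  simp at h3

end Uniform

/-! ### Transversal pairs of cones -/

section Transversal

variable {α : Type*} [Finite α] {M : Matroid α} {k l : ℕ}

lemma finrank_ambient (hcard : Nat.card α = k + l + 1) :
    Module.finrank ℝ (Ambient α) = k + l := by
  have := Fintype.ofFinite α
  have : Nonempty α := Nat.card_pos_iff.1 (by omega) |>.1
  have h := Submodule.finrank_quotient_add_finrank (Submodule.span ℝ {(1 : α → ℝ)})
  rw [finrank_span_singleton one_ne_zero, Module.finrank_fintype_fun_eq_card,
    ← Nat.card_eq_fintype_card, hcard] at h
  exact Nat.add_right_cancel h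

lemma le_add_of_span_sup_eq_top (hcard : Nat.card α = k + l + 1) {N : Matroid α} {j j' : ℕ}
    {F : ProperFlag M (j + 1)} {G : ProperFlag N (j' + 1)}
    (h : Submodule.span ℝ (flagCone F : Set (Ambient α)) ⊔
      Submodule.span ℝ (flagCone G : Set (Ambient α)) = ⊤) : k + l ≤ j + j' := by
  have := Fintype.ofFinite α
  have h1 := Submodule.finrank_add_le_finrank_add_finrank
    (Submodule.span ℝ (flagCone F : Set (Ambient α)))
    (Submodule.span ℝ (flagCone G : Set (Ambient α)))
  rwa [h, finrank_top, finrank_ambient hcard, finrank_span_flagCone, finrank_span_flagCone] at h1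

lemma meets_toAmbient_iff {α : Type*} {σ τ : PointedCone ℝ (Ambient α)} {w : α → ℝ} :
    Meets σ τ (toAmbient α w) ↔ ∃ y, toAmbient α y ∈ τ ∧ toAmbient α (y + w) ∈ σ := by
  constructor
  · rintro ⟨_, hz, z', hz', rfl⟩
    obtain ⟨y, rfl⟩ := Submodule.mkQ_surjective _ z'
    exact ⟨y, hz', by rw [map_add]; exact hz⟩
  · rintro ⟨y, h1, h2⟩
    exact ⟨_, h2, _, h1, (map_add _ _ _).symm⟩

variable {F : ProperFlag M (k + 1)} {G : ProperFlag (uniformMatroid α (l + 1)) (l + 1)}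

/-- If the cones are transversal, two elements of one block of `G` lie in different blocks of `F`:
otherwise the difference of these coordinates would vanish everywhere. -/
lemma eq_of_block_eq_of_span_sup_eq_top (hE : M.E = Set.univ)
    (h : Submodule.span ℝ (flagCone F : Set (Ambient α)) ⊔
      Submodule.span ℝ (flagCone G : Set (Ambient α)) = ⊤) {a b : α}
    (hF : F.block hE a = F.block hE b)
    (hG : G.block uniformMatroid_ground a = G.block uniformMatroid_ground b) : a = b := by
  classical
  by_contra hne
  have hmem : toAmbient α (Pi.single a 1) ∈
      Submodule.span ℝ (flagCone F : Set (Ambient α)) ⊔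
        Submodule.span ℝ (flagCone G : Set (Ambient α)) := h ▸ Submodule.mem_top
  obtain ⟨z, hz, z', hz', hzz⟩ := Submodule.mem_sup.1 hmem
  obtain ⟨x, rfl⟩ := Submodule.mkQ_surjective _ z
  obtain ⟨y, rfl⟩ := Submodule.mkQ_surjective _ z'
  obtain ⟨c, hc⟩ := toAmbient_eq_iff.1 ((map_add (toAmbient α) x y).trans hzz)
  have hx := eq_of_toAmbient_mem_span_flagCone F hE hz hF
  have hy := eq_of_toAmbient_mem_span_flagCone G uniformMatroid_ground hz' hG
  have ha := hc a
  have hb := hc b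
  rw [Pi.add_apply, Pi.single_eq_same] at ha
  rw [Pi.add_apply, Pi.single_eq_of_ne (Ne.symm hne)] at hb
  linarith

/-- If the cones are transversal, the last block of `G` meets each block of `F`. -/
lemma exists_block_eq_of_span_sup_eq_top (hE : M.E = Set.univ) (hcard : Nat.card α = k + l + 1)
    (h : Submodule.span ℝ (flagCone F : Set (Ambient α)) ⊔
      Submodule.span ℝ (flagCone G : Set (Ambient α)) = ⊤) (i : Fin (k + 1)) :
    ∃ s, F.block hE s = i ∧ G.block uniformMatroid_ground s = Fin.last l := by
  classical
  let S : Set α := (G.flat (Fin.last l).castSucc)ᶜ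
  have hS : ∀ s ∈ S, G.block uniformMatroid_ground s = Fin.last l := by
    intro s hs
    have : ¬ s ∈ G.flat (Fin.last l).castSucc := hs
    rw [G.mem_flat_iff uniformMatroid_ground, not_lt] at this
    exact Fin.last_le_iff.1 (Fin.castSucc_le_castSucc_iff.1 this)
  have hScard : S.ncard = k + 1 := by
    have h1 := Set.ncard_add_ncard_compl (G.flat (Fin.last l).castSucc)
    rw [ncard_flat_uniformMatroid, hcard, Fin.val_last] at h1
    change l + S.ncard = k + l + 1 at h1
    omega
  have hinj : Set.InjOn (F.block hE) S := fun a ha b hb hab =>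
    eq_of_block_eq_of_span_sup_eq_top hE h hab ((hS a ha).trans (hS b hb).symm)
  have himage : F.block hE '' S = Set.univ := by
    refine Set.eq_of_subset_of_ncard_le (Set.subset_univ _) ?_ (Set.toFinite _)
    rw [hinj.ncard_image, hScard, Set.ncard_univ, Nat.card_eq_fintype_card,
      Fintype.card_fin]
  obtain ⟨s, hs, hsi⟩ := himage.symm ▸ Set.mem_univ i
  exact ⟨s, hsi, hS s hs⟩

/-- The lattices of transversal cones generate the ambient lattice. -/
lemma coneLattice_sup_eq (hE : M.E = Set.univ) (hcard : Nat.card α = k + l + 1)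
    (h : Submodule.span ℝ (flagCone F : Set (Ambient α)) ⊔
      Submodule.span ℝ (flagCone G : Set (Ambient α)) = ⊤) :
    coneLattice (flagCone F) ⊔ coneLattice (flagCone G) = ambientLattice α := by
  refine le_antisymm (sup_le inf_le_left inf_le_left) ?_
  have hlat : ∀ z : α → ℤ, toAmbient α (fun a => (z a : ℝ)) ∈ ambientLattice α := fun z =>
    ⟨fun a => (z a : ℝ), ⟨z, rfl⟩, rfl⟩
  rintro _ ⟨_, ⟨z, rfl⟩, rfl⟩
  choose s hsF hsG using exists_block_eq_of_span_sup_eq_top hE hcard h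
  -- `z` is split into a function constant on the blocks of `F` and one vanishing on the last
  -- block of `G`.
  refine AddSubgroup.mem_sup.2 ⟨toAmbient α (fun a => (z (s (F.block hE a)) : ℝ)),
    ⟨hlat fun a => z (s (F.block hE a)), ?_⟩,
    toAmbient α (fun a => ((z a - z (s (F.block hE a)) : ℤ) : ℝ)),
    ⟨hlat fun a => z a - z (s (F.block hE a)), ?_⟩, ?_⟩
  · exact toAmbient_mem_span_flagCone F hE fun a b hab => by rw [hab]
  · refine toAmbient_mem_span_flagCone G uniformMatroid_ground fun a b hab => ?_
    by_cases hlast : G.block uniformMatroid_ground a = Fin.last l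
    · have hvan : ∀ c, G.block uniformMatroid_ground c = Fin.last l →
          s (F.block hE c) = c := fun c hc =>
        eq_of_block_eq_of_span_sup_eq_top hE h (hsF _) ((hsG _).trans hc.symm)
      rw [hvan a hlast, hvan b (hab ▸ hlast), sub_self, sub_self]
    · rw [eq_of_block_eq_uniformMatroid G hab hlast]
  · rw [← map_add]
    change toAmbient α _ = toAmbient α _
    congr 1
    ext a
    simp

end Transversal

/-! ### Counting the cones of the uniform matroid that meet a given cone -/

section Count

variable {α : Type*} [Finite α] {M : Matroid α} {k l : ℕ} {w : α → ℝ}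
  {c : ProperFlag M (k + 1) → ℤ} {c' : ProperFlag (uniformMatroid α (l + 1)) (l + 1) → ℤ}

/-- For a generic perturbation, a point of `|T| ∩ (|T'| + v)` lies in the relative interior of cones
of top dimension. -/
lemma ncard_range_of_isGeneric (hE : M.E = Set.univ) (hM : M.IsFlat ∅)
    (hcard : Nat.card α = k + l + 1)
    (hgen : IsGeneric (skeleton M k c) (skeleton (uniformMatroid α (l + 1)) l c')
      (toAmbient α w))
    {F : ProperFlag M (k + 1)} {G : ProperFlag (uniformMatroid α (l + 1)) (l + 1)} {y : α → ℝ}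
    (hy : toAmbient α y ∈ flagCone G) (hx : toAmbient α (y + w) ∈ flagCone F) :
    (Set.range (y + w)).ncard = k + 1 ∧ (Set.range y).ncard = l + 1 := by
  have hne : Nonempty α := Nat.card_pos_iff.1 (by omega) |>.1
  have hUM : (uniformMatroid α (l + 1)).IsFlat ∅ :=
    uniformMatroid_isFlat_of_ncard_lt (by simp)
  have hF := ncard_range_le_of_mem_flagCone F hE hx
  have hG := ncard_range_le_of_mem_flagCone G uniformMatroid_ground hy
  obtain ⟨j, F', hj, hF'⟩ :=
    exists_flag_of_isFlat_superlevel hE hM (isFlat_superlevel_of_mem_flagCone F hE hx)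
  obtain ⟨j', G', hj', hG'⟩ := exists_flag_of_isFlat_superlevel uniformMatroid_ground hUM
    (isFlat_superlevel_of_mem_flagCone G uniformMatroid_ground hy)
  have h := le_add_of_span_sup_eq_top hcard (hgen j (show j ≤ k by omega) j' (show j' ≤ l by omega)
    F' G' (meets_toAmbient_iff.2 ⟨y, hG', hF'⟩))
  omega

/-- If the cone of `F` meets a translated cone, then the maximum of `w` outside each flat of `F` is
attained in the next flat only. -/
lemma mem_flat_of_meets (hE : M.E = Set.univ) (hM : M.IsFlat ∅)
    (hcard : Nat.card α = k + l + 1)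
    (hgen : IsGeneric (skeleton M k c) (skeleton (uniformMatroid α (l + 1)) l c')
      (toAmbient α w))
    {F : ProperFlag M (k + 1)} {G : ProperFlag (uniformMatroid α (l + 1)) (l + 1)}
    (hmeets : Meets (flagCone F) (flagCone G) (toAmbient α w)) (i : Fin (k + 1)) {b : α}
    (hmax : ∀ a ∉ F.flat i.castSucc, w a ≤ w b) :
    b ∈ F.flat i.succ := by
  have hspan := hgen k le_rfl l le_rfl F G hmeets
  obtain ⟨y, hy, hx⟩ := meets_toAmbient_iff.1 hmeets
  obtain ⟨hcx, -⟩ := ncard_range_of_isGeneric hE hM hcard hgen hy hx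
  obtain ⟨s, hsF, hsG⟩ := exists_block_eq_of_span_sup_eq_top hE hcard hspan i
  rw [F.mem_flat_iff hE, Fin.castSucc_lt_succ_iff]
  by_contra hlt
  have hs : s ∉ F.flat i.castSucc := by
    rw [F.mem_flat_iff hE, hsF]; exact lt_irrefl _
  have h1 : (y + w) b < (y + w) s := by
    rw [← not_le, ← block_le_iff_of_ncard_range F hE hx hcx, hsF]
    exact hlt
  have h2 : y s ≤ y b := (toAmbient_mem_flagCone_iff G uniformMatroid_ground).1 hy b s
    (by rw [hsG]; exact Fin.le_last _)
  have h3 := hmax s hs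
  simp only [Pi.add_apply] at h1
  linarith

/-- If the elements `s i` at which `w` is maximal outside the flats of `F` lie in the respective
next flat, then the cone of `F` meets a translated cone: the point is the one whose
coordinates on the `i`-th block are `w (s i)`. -/
lemma exists_meets (hE : M.E = Set.univ) (hcard : Nat.card α = k + l + 1)
    (hgen : IsGeneric (skeleton M k c) (skeleton (uniformMatroid α (l + 1)) l c')
      (toAmbient α w))
    {F : ProperFlag M (k + 1)} (s : Fin (k + 1) → α) (hs : ∀ i, s i ∉ F.flat i.castSucc)
    (hs' : ∀ i, s i ∈ F.flat i.succ) (hmax : ∀ i, ∀ a ∉ F.flat i.castSucc, w a ≤ w (s i)) :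
    ∃ G : ProperFlag (uniformMatroid α (l + 1)) (l + 1),
      Meets (flagCone F) (flagCone G) (toAmbient α w) := by
  have hne : Nonempty α := Nat.card_pos_iff.1 (by omega) |>.1
  have hUM : (uniformMatroid α (l + 1)).IsFlat ∅ :=
    uniformMatroid_isFlat_of_ncard_lt (by simp)
  have hblock : ∀ i, F.block hE (s i) = i := by
    intro i
    have h1 := hs i
    have h2 := hs' i
    rw [F.mem_flat_iff hE] at h1 h2
    rw [not_lt, Fin.castSucc_le_castSucc_iff] at h1
    rw [Fin.castSucc_lt_succ_iff] at h2
    exact le_antisymm h2 h1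
  have hout : ∀ i a, i ≤ F.block hE a → a ∉ F.flat i.castSucc := by
    intro i a h
    rw [F.mem_flat_iff hE, not_lt, Fin.castSucc_le_castSucc_iff]
    exact h
  let y : α → ℝ := fun a => w (s (F.block hE a)) - w a
  have hy0 : ∀ a, 0 ≤ y a := fun a => sub_nonneg.2 (hmax _ a (hout _ a le_rfl))
  have hys : ∀ i, y (s i) = 0 := fun i => by simp only [y, hblock, sub_self]
  have hinj : Function.Injective s := Function.LeftInverse.injective hblock
  have hcompl : (Set.range s)ᶜ.ncard = l := by
    have h1 := Set.ncard_add_ncard_compl (Set.range s)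
    rw [← Set.image_univ, Set.ncard_image_of_injective _ hinj, Set.ncard_univ,
      Nat.card_eq_fintype_card, Fintype.card_fin, hcard, Set.image_univ] at h1
    omega
  have hx : toAmbient α (y + w) ∈ flagCone F := by
    refine (toAmbient_mem_flagCone_iff F hE).2 fun a b hab => ?_
    simp only [y, Pi.add_apply, sub_add_cancel]
    exact hmax _ _ (hout _ _ (by rw [hblock]; exact hab))
  have hyflat : ∀ t, (uniformMatroid α (l + 1)).IsFlat {a | t ≤ y a} := by
    intro t
    by_cases ht : t ≤ 0
    · have : {a | t ≤ y a} = (uniformMatroid α (l + 1)).E := by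
        ext a
        simpa [uniformMatroid_ground] using ht.trans (hy0 a)
      rw [this]
      exact (uniformMatroid α (l + 1)).ground_isFlat
    · refine uniformMatroid_isFlat_of_ncard_lt (Nat.lt_succ_iff.2 (hcompl ▸ ?_))
      refine Set.ncard_le_ncard ?_ (Set.toFinite _)
      rintro a ha ⟨i, rfl⟩
      rw [Set.mem_ofPred_eq, hys] at ha
      exact ht ha
  have hyrange : (Set.range y).ncard ≤ l + 1 := by
    have hsub : Set.range y ⊆ insert 0 (y '' (Set.range s)ᶜ) := by
      rintro _ ⟨a, rfl⟩
      by_cases ha : a ∈ Set.range s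
      · obtain ⟨i, rfl⟩ := ha
        exact Or.inl (hys i)
      · exact Or.inr ⟨a, ha, rfl⟩
    calc (Set.range y).ncard ≤ (insert 0 (y '' (Set.range s)ᶜ)).ncard :=
          Set.ncard_le_ncard hsub (Set.toFinite _)
      _ ≤ (y '' (Set.range s)ᶜ).ncard + 1 := Set.ncard_insert_le _ _
      _ ≤ l + 1 := by
        have := Set.ncard_image_le (f := y) (Set.toFinite (Set.range s)ᶜ)
        omega
  obtain ⟨j, G, hj, hG⟩ := exists_flag_of_isFlat_superlevel uniformMatroid_ground hUM hyflat
  have hm : Meets (flagCone F) (flagCone G) (toAmbient α w) :=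
    meets_toAmbient_iff.2 ⟨y, hG, hx⟩
  have h := le_add_of_span_sup_eq_top hcard
    (hgen k le_rfl j (show j ≤ l by omega) F G hm)
  obtain rfl : j = l := by omega
  exact ⟨G, hm⟩

/-- The cone of `F` meets at most one of the translated cones. -/
lemma eq_of_meets (hE : M.E = Set.univ) (hM : M.IsFlat ∅)
    (hcard : Nat.card α = k + l + 1)
    (hgen : IsGeneric (skeleton M k c) (skeleton (uniformMatroid α (l + 1)) l c')
      (toAmbient α w))
    {F : ProperFlag M (k + 1)} {G G' : ProperFlag (uniformMatroid α (l + 1)) (l + 1)}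
    (hG : Meets (flagCone F) (flagCone G) (toAmbient α w))
    (hG' : Meets (flagCone F) (flagCone G') (toAmbient α w)) : G = G' := by
  obtain ⟨y, hy, hx⟩ := meets_toAmbient_iff.1 hG
  obtain ⟨y', hy', hx'⟩ := meets_toAmbient_iff.1 hG'
  -- On a block of `F`, the point of the intersection is the maximum of `w` up to a constant.
  have key : ∀ {G G' : ProperFlag (uniformMatroid α (l + 1)) (l + 1)} {y y' : α → ℝ},
      Meets (flagCone F) (flagCone G') (toAmbient α w) →
      toAmbient α y ∈ flagCone G → toAmbient α (y + w) ∈ flagCone F →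
      toAmbient α y' ∈ flagCone G' → toAmbient α (y' + w) ∈ flagCone F →
      ∀ s s', G.block uniformMatroid_ground s = Fin.last l →
        G'.block uniformMatroid_ground s' = Fin.last l → ∀ a, y' a - y a ≤ y' s' - y s := by
    intro G G' y y' hG' hy hx hy' hx' s s' hs hs' a
    obtain ⟨b, hbF, hbG⟩ := exists_block_eq_of_span_sup_eq_top hE hcard
      (hgen k le_rfl l le_rfl F G' hG') (F.block hE a)
    have h1 := eq_of_toAmbient_mem_span_flagCone F hE (Submodule.subset_span hx) hbF
    have h2 := eq_of_toAmbient_mem_span_flagCone F hE (Submodule.subset_span hx') hbF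
    have h3 : y' b = y' s' := eq_of_toAmbient_mem_span_flagCone G' uniformMatroid_ground
      (Submodule.subset_span hy') (hbG.trans hs'.symm)
    have h4 : y s ≤ y b := (toAmbient_mem_flagCone_iff G uniformMatroid_ground).1 hy b s
      (by rw [hs]; exact Fin.le_last _)
    simp only [Pi.add_apply] at h1 h2
    linarith
  obtain ⟨s, hs⟩ := G.block_surjective uniformMatroid_ground (Fin.last l)
  obtain ⟨s', hs'⟩ := G'.block_surjective uniformMatroid_ground (Fin.last l)
  have hconst : ∀ a, y' a - y a = y' s' - y s := by
    intro a
    have h1 := key hG' hy hx hy' hx' s s' hs hs' a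
    have h2 := key hG hy' hx' hy hx s' s hs' hs a
    linarith
  have hcy := (ncard_range_of_isGeneric hE hM hcard hgen hy hx).2
  have hcy' := (ncard_range_of_isGeneric hE hM hcard hgen hy' hx').2
  have hiff : ∀ a b, G.block uniformMatroid_ground a ≤ G.block uniformMatroid_ground b ↔
      G'.block uniformMatroid_ground a ≤ G'.block uniformMatroid_ground b := by
    intro a b
    rw [block_le_iff_of_ncard_range G uniformMatroid_ground hy hcy,
      block_le_iff_of_ncard_range G' uniformMatroid_ground hy' hcy']
    have ha := hconst a
    have hb := hconst b
    constructor <;> intro h <;> linarith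
  ext1
  funext i
  refine Fin.lastCases ?_ (fun i => ?_) i
  · rw [G.flat_last, G'.flat_last]
  · -- Two different sets of the same size would order some pair of elements differently.
    have hcardi : (G.flat i.castSucc).ncard = (G'.flat i.castSucc).ncard := by
      rw [ncard_flat_uniformMatroid, ncard_flat_uniformMatroid]
    by_contra hne
    have h1 : ¬ G.flat i.castSucc ⊆ G'.flat i.castSucc := fun h =>
      hne (Set.eq_of_subset_of_ncard_le h hcardi.ge (Set.toFinite _))
    have h2 : ¬ G'.flat i.castSucc ⊆ G.flat i.castSucc := fun h =>
      hne (Set.eq_of_subset_of_ncard_le h hcardi.le (Set.toFinite _)).symm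
    obtain ⟨a, ha, ha'⟩ := Set.not_subset.1 h1
    obtain ⟨b, hb, hb'⟩ := Set.not_subset.1 h2
    rcases le_total (G.block uniformMatroid_ground a) (G.block uniformMatroid_ground b) with h | h
    · exact ha' ((G'.block_le_iff uniformMatroid_ground).1 ((hiff a b).1 h) _ hb)
    · exact hb' ((G.block_le_iff uniformMatroid_ground).1 h _ ha)

end Count

/-! ### The stable intersection of fans of complementary dimension -/

section StableIntersection

open Filter Topology

variable {α : Type*} [Finite α]

instance t2Space_ambient : T2Space (Ambient α) := by
  have := Fintype.ofFinite α
  have : IsClosed ((Submodule.span ℝ {(1 : α → ℝ)} : Submodule ℝ (α → ℝ)) : Set (α → ℝ)) :=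
    Submodule.closed_of_finiteDimensional _
  infer_instance

instance finiteDimensional_ambient : FiniteDimensional ℝ (Ambient α) := by
  have := Fintype.ofFinite α
  infer_instance

variable {T T' : WeightedFan α} {v : Ambient α}

/-- The non-generic vectors lie in the proper subspaces `span σ + span σ'`. -/
theorem dense_isGeneric (T T' : WeightedFan α) : Dense {v | IsGeneric T T' v} := by
  let ι := Σ j : Fin (T.dim + 1), Σ j' : Fin (T'.dim + 1), T.Idx j × T'.Idx j'
  have hι : Finite ι := by
    have := T.finite_idx
    have := T'.finite_idx
    infer_instance
  let V : ι → Submodule ℝ (Ambient α) := fun p =>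
    Submodule.span ℝ (T.cone p.1 p.2.2.1 : Set (Ambient α)) ⊔
      Submodule.span ℝ (T'.cone p.2.1 p.2.2.2 : Set (Ambient α))
  have hdense : Dense (⋂₀ ((fun p => ((V p : Set (Ambient α)))ᶜ) '' {p | V p ≠ ⊤})) := by
    refine (Set.toFinite _).dense_sInter ?_ ?_
    · rintro _ ⟨p, -, rfl⟩
      exact (Submodule.closed_of_finiteDimensional (V p)).isOpen_compl
    · rintro _ ⟨p, hp, rfl⟩
      rw [← interior_eq_empty_iff_dense_compl, ← Set.not_nonempty_iff_eq_empty]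
      exact fun h => hp ((V p).eq_top_of_nonempty_interior' h)
  refine hdense.mono fun v hv j hj j' hj' i i' hmeets => ?_
  by_contra hne
  refine Set.mem_sInter.1 hv _ ⟨⟨⟨j, Nat.lt_succ_iff.2 hj⟩, ⟨j', Nat.lt_succ_iff.2 hj'⟩, i, i'⟩,
    hne, rfl⟩ ?_
  obtain ⟨_, hz, z', hz', rfl⟩ := hmeets
  have h : v = (z' + v) - z' := by abel
  change v ∈ V _
  rw [h]
  exact Submodule.sub_mem _ (Submodule.mem_sup_left (Submodule.subset_span hz))
    (Submodule.mem_sup_right (Submodule.subset_span hz'))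

lemma subsingleton_inter_of_span_sup_eq_top {σ τ : PointedCone ℝ (Ambient α)}
    (h : Submodule.span ℝ (σ : Set (Ambient α)) ⊔ Submodule.span ℝ (τ : Set (Ambient α)) = ⊤)
    (hdim : Module.finrank ℝ (Submodule.span ℝ (σ : Set (Ambient α))) +
      Module.finrank ℝ (Submodule.span ℝ (τ : Set (Ambient α))) ≤
        Module.finrank ℝ (Ambient α)) (v : Ambient α) :
    ((σ : Set (Ambient α)) ∩ ((fun x => x + v) '' (τ : Set (Ambient α)))).Subsingleton := by
  have h1 := Submodule.finrank_sup_add_finrank_inf_eq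
    (Submodule.span ℝ (σ : Set (Ambient α))) (Submodule.span ℝ (τ : Set (Ambient α)))
  rw [h, finrank_top] at h1
  have h2 : Submodule.span ℝ (σ : Set (Ambient α)) ⊓ Submodule.span ℝ (τ : Set (Ambient α)) = ⊥ :=
    Submodule.finrank_eq_zero.1 (by omega)
  rintro _ ⟨hx, x, hx', rfl⟩ _ ⟨hy, y, hy', rfl⟩
  have h3 : x - y ∈ Submodule.span ℝ (σ : Set (Ambient α)) ⊓
      Submodule.span ℝ (τ : Set (Ambient α)) := by
    refine ⟨?_, Submodule.sub_mem _ (Submodule.subset_span hx') (Submodule.subset_span hy')⟩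
    have : x - y = (x + v) - (y + v) := by abel
    rw [this]
    exact Submodule.sub_mem _ (Submodule.subset_span hx) (Submodule.subset_span hy)
  rw [h2, Submodule.mem_bot, sub_eq_zero] at h3
  rw [h3]

lemma finite_support_inter (hdim : T.dim + T'.dim ≤ Module.finrank ℝ (Ambient α))
    (hgen : IsGeneric T T' v) :
    (T.support ∩ ((fun x => x + v) '' T'.support)).Finite := by
  have hsub : T.support ∩ ((fun x => x + v) '' T'.support) ⊆
      ⋃ j ∈ Set.Iic T.dim, ⋃ j' ∈ Set.Iic T'.dim, ⋃ i : T.Idx j, ⋃ i' : T'.Idx j',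
        (T.cone j i : Set (Ambient α)) ∩
          ((fun x => x + v) '' (T'.cone j' i' : Set (Ambient α))) := by
    rintro _ ⟨hz, z, hz', rfl⟩
    simp only [WeightedFan.support, Set.mem_iUnion] at hz hz'
    obtain ⟨j, hj, i, hi⟩ := hz
    obtain ⟨j', hj', i', hi'⟩ := hz'
    simp only [Set.mem_iUnion]
    exact ⟨j, hj, j', hj', i, i', hi, z, hi', rfl⟩
  refine Set.Finite.subset ?_ hsub
  refine (Set.finite_Iic _).biUnion fun j hj => (Set.finite_Iic _).biUnion fun j' hj' => ?_
  have := T.finite_idx j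
  have := T'.finite_idx j'
  refine Set.finite_iUnion fun i => Set.finite_iUnion fun i' => ?_
  rcases Set.eq_empty_or_nonempty ((T.cone j i : Set (Ambient α)) ∩
    ((fun x => x + v) '' (T'.cone j' i' : Set (Ambient α)))) with h | h
  · rw [h]; exact Set.finite_empty
  · refine (subsingleton_inter_of_span_sup_eq_top (hgen j hj j' hj' i i' h) ?_ v).finite
    rw [T.finrank_span, T'.finrank_span]
    exact (add_le_add hj hj').trans hdim

lemma WeightedFan.smul_mem_support {α : Type*} (T : WeightedFan α) {ε : ℝ} (hε : 0 ≤ ε)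
    {x : Ambient α} (hx : x ∈ T.support) : ε • x ∈ T.support := by
  simp only [WeightedFan.support, Set.mem_iUnion] at hx ⊢
  obtain ⟨j, hj, i, hi⟩ := hx
  exact ⟨j, hj, i, Submodule.smul_mem _ (⟨ε, hε⟩ : {c : ℝ // 0 ≤ c}) hi⟩

lemma smul_mem_support_inter {α : Type*} {T T' : WeightedFan α} {ε : ℝ} (hε : 0 ≤ ε)
    {u z : Ambient α} (hz : z ∈ T.support ∩ ((fun x => x + u) '' T'.support)) :
    ε • z ∈ T.support ∩ ((fun x => x + ε • u) '' T'.support) := by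
  obtain ⟨h1, z', h2, rfl⟩ := hz
  exact ⟨T.smul_mem_support hε h1, ε • z', T'.smul_mem_support hε h2, (smul_add _ _ _).symm⟩

/-- The sets `|T| ∩ (|T'| + εv)` are the multiples of a finite set by `ε`, so they shrink to the
origin. -/
lemma stableSupport_subset (hdim : T.dim + T'.dim ≤ Module.finrank ℝ (Ambient α))
    (hgen : IsGeneric T T' v) : stableSupport T T' v ⊆ {0} := by
  rintro p ⟨x, hx, hlim⟩
  have hK := finite_support_inter hdim hgen
  refine tendsto_nhds_unique hlim fun U hU => ?_
  have hzU : ∀ᶠ ε in 𝓝[>] (0 : ℝ),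
      ∀ z ∈ T.support ∩ ((fun x => x + v) '' T'.support), ε • z ∈ U := by
    refine (Filter.eventually_all_finite hK).2 fun z _ => ?_
    have hcont : Tendsto (fun ε : ℝ => ε • z) (𝓝[>] 0) (𝓝 0) := by
      have h : Tendsto (fun ε : ℝ => ε • z) (𝓝 0) (𝓝 ((0 : ℝ) • z)) :=
        (continuous_id.smul continuous_const).tendsto 0
      rw [zero_smul] at h
      exact h.mono_left nhdsWithin_le_nhds
    exact hcont hU
  change ∀ᶠ ε in 𝓝[>] (0 : ℝ), x ε ∈ U
  filter_upwards [hx, hzU, self_mem_nhdsWithin] with ε h1 h2 h3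
  have hε : (0 : ℝ) < ε := h3
  have h4 := smul_mem_support_inter (inv_nonneg.2 hε.le) h1
  rw [inv_smul_smul₀ hε.ne'] at h4
  have h5 := h2 _ h4
  rwa [smul_inv_smul₀ hε.ne'] at h5

lemma mem_stableSupport_of_meets {α : Type*} {T T' : WeightedFan α} {v : Ambient α}
    {i : T.Idx T.dim} {i' : T'.Idx T'.dim}
    (h : Meets (T.cone T.dim i) (T'.cone T'.dim i') v) :
    (0 : Ambient α) ∈ stableSupport T T' v := by
  obtain ⟨_, hz, z', hz', rfl⟩ := h
  have h1 : z' + v ∈ T.support ∩ ((fun x => x + v) '' T'.support) := by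
    refine ⟨?_, z', ?_, rfl⟩
    · simp only [WeightedFan.support, Set.mem_iUnion]
      exact ⟨_, le_rfl, i, hz⟩
    · simp only [WeightedFan.support, Set.mem_iUnion]
      exact ⟨_, le_rfl, i', hz'⟩
  refine ⟨fun ε => ε • (z' + v), ?_, ?_⟩
  · filter_upwards [self_mem_nhdsWithin] with ε hε
    exact smul_mem_support_inter (le_of_lt hε) h1
  · have h : Tendsto (fun ε : ℝ => ε • (z' + v)) (𝓝 0) (𝓝 ((0 : ℝ) • (z' + v))) :=
      (continuous_id.smul continuous_const).tendsto 0
    rw [zero_smul] at h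
    exact h.mono_left nhdsWithin_le_nhds

/-- The degree of a stable intersection of fans of complementary dimension is the sum of the
multiplicities over the pairs of cones that meet after the perturbation. If there are none, then the
support is empty, and both sides vanish. -/
lemma finsum_stableWeight (hdim : T.dim + T'.dim ≤ Module.finrank ℝ (Ambient α))
    (hgen : IsGeneric T T' v) :
    ∑ᶠ (p : Ambient α) (_ : p ∈ stableSupport T T' v), stableWeight T T' v {p} =
      stableWeight T T' v {0} := by
  by_cases h : ∃ i i', Meets (T.cone T.dim i) (T'.cone T'.dim i') v
  · obtain ⟨i, i', h⟩ := h
    rw [(stableSupport_subset hdim hgen).antisymm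
      (Set.singleton_subset_iff.2 (mem_stableSupport_of_meets h)), finsum_mem_singleton]
  · push Not at h
    have hz : ∀ γ, stableWeight T T' v γ = 0 := fun γ => by
      rw [stableWeight, finsum_eq_zero_of_forall_eq_zero]
      exact fun p => if_neg fun hp => h _ _ hp.2.2
    simp [hz]

end StableIntersection

/-! ### The degree of a skeleton -/

section Degree

variable {α : Type*} [Finite α] {M : Matroid α} {k l : ℕ} {w : α → ℝ}

open Classical in
/-- For a choice `e A` of a point outside `A` at which `w` is maximal, the degree of a weighted
skeleton is the sum of the weights of the flags in which each flat contains the chosen point outside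
the preceding one. -/
theorem stableWeight_skeleton [Fintype (ProperFlag M (k + 1))]
    (hE : M.E = Set.univ) (hM : M.IsFlat ∅)
    (hcard : Nat.card α = k + l + 1) (c : ProperFlag M (k + 1) → ℤ)
    (hgen : IsGeneric (skeleton M k c) (skeleton (uniformMatroid α (l + 1)) l fun _ => 1)
      (toAmbient α w))
    {e : Set α → α} (he : ∀ A ≠ Set.univ, e A ∉ A) (hmax : ∀ A, ∀ a ∉ A, w a ≤ w (e A)) :
    stableWeight (skeleton M k c) (skeleton (uniformMatroid α (l + 1)) l fun _ => 1)
      (toAmbient α w) {0} =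
      ∑ F : ProperFlag M (k + 1),
        if ∀ i : Fin (k + 1), e (F.flat i.castSucc) ∈ F.flat i.succ then c F else 0 := by
  have := Fintype.ofFinite (ProperFlag (uniformMatroid α (l + 1)) (l + 1))
  have hsum : stableWeight (skeleton M k c)
      (skeleton (uniformMatroid α (l + 1)) l fun _ => 1) (toAmbient α w) {0} =
      ∑ p : ProperFlag M (k + 1) × ProperFlag (uniformMatroid α (l + 1)) (l + 1),
        if Meets (flagCone p.1) (flagCone p.2) (toAmbient α w) then c p.1 else 0 := by
    have hzero : ∀ σ : PointedCone ℝ (Ambient α), ({0} : Set (Ambient α)) ⊆ σ := fun σ =>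
      Set.singleton_subset_iff.2 σ.zero_mem
    have hterm : ∀ p : ProperFlag M (k + 1) × ProperFlag (uniformMatroid α (l + 1)) (l + 1),
        (if ({0} : Set (Ambient α)) ⊆ flagCone p.1 ∧ ({0} : Set (Ambient α)) ⊆ flagCone p.2 ∧
            Meets (flagCone p.1) (flagCone p.2) (toAmbient α w) then
          c p.1 * 1 * ((coneLattice (flagCone p.1) ⊔ coneLattice (flagCone p.2)).relIndex
            (ambientLattice α) : ℤ) else 0) =
        if Meets (flagCone p.1) (flagCone p.2) (toAmbient α w) then c p.1 else 0 := by
      intro p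
      by_cases h : Meets (flagCone p.1) (flagCone p.2) (toAmbient α w)
      · rw [if_pos ⟨hzero _, hzero _, h⟩, if_pos h,
          coneLattice_sup_eq hE hcard (hgen k le_rfl l le_rfl p.1 p.2 h),
          AddSubgroup.relIndex_self]
        simp
      · rw [if_neg h, if_neg fun h' => h h'.2.2]
    exact (finsum_congr hterm).trans (finsum_eq_sum_of_fintype _)
  rw [hsum, Fintype.sum_prod_type]
  refine Finset.sum_congr rfl fun F _ => ?_
  have hne : ∀ i : Fin (k + 1), F.flat i.castSucc ≠ Set.univ := fun i h => by
    have h1 := F.strictMono (Fin.castSucc_lt_succ (i := i))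
    rw [h] at h1
    exact h1.2 (Set.subset_univ _)
  split_ifs with h
  · obtain ⟨G, hG⟩ := exists_meets hE hcard hgen (F := F) (fun i => e (F.flat i.castSucc))
      (fun i => he _ (hne i)) h (fun i => hmax _)
    rw [Finset.sum_eq_single G]
    · rw [if_pos hG]
    · exact fun G' _ hG' => if_neg fun h' => hG' (eq_of_meets hE hM hcard hgen h' hG)
    · simp
  · refine Finset.sum_eq_zero fun G _ => if_neg fun hG => h fun i => ?_
    exact mem_flat_of_meets hE hM hcard hgen hG i (hmax _)

end Degree

end CSM

theorem theorem3p2 (n d k : ℕ) (M : Matroid (Fin (n + 1))) (hE : M.E = Set.univ)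
    (hloopless : M.Loopless) (hrank : M.eRank = (d + 1 : ℕ)) (hk : k ≤ d) :
    Dense {v | CSM.IsGeneric (CSM.csmCycle M k) (CSM.complementaryFan (CSM.csmCycle M k)) v} ∧
    ∀ v, CSM.IsGeneric (CSM.csmCycle M k) (CSM.complementaryFan (CSM.csmCycle M k)) v →
      (CSM.stableSupport (CSM.csmCycle M k) (CSM.complementaryFan (CSM.csmCycle M k)) v).Finite ∧
      CSM.degree (CSM.csmCycle M k) v = (-1) ^ (d - k) * CSM.tutteCoeff M (k + 1) 0 := by
  classical
  refine ⟨CSM.dense_isGeneric _ _, fun v hgen => ?_⟩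
  have hM : M.IsFlat ∅ := Matroid.isFlat_iff_closure_eq.2 (by
    rw [← Matroid.loops]; exact M.loops_eq_empty)
  have hdn : d ≤ n := by
    have h := M.eRank_le_encard_ground
    rw [hrank, hE, Set.encard_univ, ENat.card_eq_coe_fintype_card, Fintype.card_fin] at h
    have : d + 1 ≤ n + 1 := by exact_mod_cast h
    omega
  obtain ⟨l, rfl⟩ : ∃ l, n = k + l := ⟨n - k, by omega⟩
  have hcard : Nat.card (Fin (k + l + 1)) = k + l + 1 := by simp
  have hfan : CSM.complementaryFan (CSM.csmCycle M k) =
      CSM.skeleton (CSM.uniformMatroid (Fin (k + l + 1)) (l + 1)) l fun _ => 1 := by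
    have h1 : Nat.card (Fin (k + l + 1)) - (CSM.csmCycle M k).dim = l + 1 := by
      change Nat.card (Fin (k + l + 1)) - k = l + 1
      omega
    have h2 : (CSM.uniformMatroid (Fin (k + l + 1)) (l + 1)).eRank.toNat - 1 = l := by
      rw [CSM.uniformMatroid_eRank (by omega)]
      rfl
    rw [CSM.complementaryFan, h1, CSM.bergmanFan, h2]
  have hdim : (CSM.csmCycle M k).dim + (CSM.complementaryFan (CSM.csmCycle M k)).dim ≤
      Module.finrank ℝ (CSM.Ambient (Fin (k + l + 1))) := by
    rw [hfan, CSM.finrank_ambient hcard]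
    exact le_rfl
  refine ⟨(Set.finite_singleton 0).subset (CSM.stableSupport_subset hdim hgen), ?_⟩
  rw [CSM.degree, CSM.finsum_stableWeight hdim hgen]
  obtain ⟨w, rfl⟩ := Submodule.mkQ_surjective _ v
  have he : ∀ A : Set (Fin (k + l + 1)), ∃ b, (A ≠ Set.univ → b ∉ A) ∧ ∀ a ∉ A, w a ≤ w b := by
    intro A
    by_cases hA : A = Set.univ
    · exact ⟨0, by simp [hA], by simp [hA]⟩
    · obtain ⟨b, hb, hmax⟩ := Set.exists_max_image Aᶜ w (Set.toFinite _)
        (Set.nonempty_compl.2 hA)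
      exact ⟨b, fun _ => hb, hmax⟩
  choose e he hmax using he
  have := Fintype.ofFinite (CSM.ProperFlag M (k + 1))
  rw [hfan] at hgen ⊢
  rw [CSM.csmCycle] at hgen ⊢
  rw [CSM.stableWeight_skeleton hE hM hcard _ hgen he hmax,
    ← CSM.tutteCoeff_eq_sum_flags M hE hM he, Finset.mul_sum]
  refine Finset.sum_congr rfl fun F _ => ?_
  rw [hrank, mul_ite, mul_zero]
  rfl
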